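/- **Definitions.** All spaces are over $\mathbb C$, and $p(\cdot)$ denotes parity. Let $\chi^1,\chi^2$ be odd and $\lambda$ even and central with $\chi^i\chi^j+\chi^j\chi^i=-2\delta_{ij}\lambda$. Write $\Lambda=(\lambda,\chi^1,\chi^2)$ and let $\Gamma=(\gamma,\eta^1,\eta^2)$ be a second such set of variables, whose odd members anticommute with $\chi^1,\chi^2$. An *$N_K=2$ SUSY vertex algebra* is a vector superspace $V$ with odd endomorphisms $D^1,D^2$ such that $(D^1)^2=(D^2)^2=:\partial$ and $D^1D^2+D^2D^1=0$, a parity preserving bilinear $\Lambda$-bracket $[a\,{}_\Lambda\, b]\in\mathbb C[\lambda,\chi^1,\chi^2]\otimes V$, an even vector $|0\rangle$, and a parity preserving bilinear product $ab$ with two-sided unit $|0\rangle$, for which $D^1,D^2$ are odd derivations, such that for homogeneous $a,b$ and all $c$: * (sesquilinearity) $[D^ia\,{}_\Lambda\, b]=-\chi^i[a\,{}_\Lambda\, b]$ and $[a\,{}_\Lambda\, D^ib]=(-1)^{p(a)}(D^i+\chi^i)[a\,{}_\Lambda\, b]$, where $D^i\chi^j+\chi^jD^i=2\delta_{ij}\lambda$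 and $D^i\lambda=\lambda D^i$; * (skew-symmetry) $[b\,{}_\Lambda\, a]=-(-1)^{p(a)p(b)}[a\,{}_{-\nabla-\Lambda}\, b]$, where $-\nabla-\Lambda=(-\partial-\lambda,-D^1-\chi^1,-D^2-\chi^2)$; * (Jacobi identity) $[a\,{}_\Lambda[b\,{}_\Gamma\, c]]=[[a\,{}_\Lambda\, b]\,{}_{\Lambda+\Gamma}\,c]+(-1)^{p(a)p(b)}[b\,{}_\Gamma[a\,{}_\Lambda\, c]]$; * (quasi-commutativity) $ab-(-1)^{p(a)p(b)}ba=\int_{-\nabla}^0[a\,{}_\Lambda\, b]\,d\Lambda$; * (quasi-associativity) $(ab)c-a(bc)=\left(\int_0^\nabla d\Lambda\, a\right)[b\,{}_\Lambda\, c]+(-1)^{p(a)p(b)}\left(\int_0^\nabla d\Lambda\, b\right)[a\,{}_\Lambda\, c]$, where the powers of $\partial$ produced by the integral act on the left factor; * (Wick formula) $[a\,{}_\Lambda\, bc]=[a\,{}_\Lambda\, b]c+(-1)^{p(a)p(b)}b[a\,{}_\Lambda\, c]+\int_0^\Lambda[[a\,{}_\Lambda\, b]\,{}_\Gamma\, c]\,d\Gamma$.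 Here $\int_0^\Lambda d\Gamma=\partial_{\eta^1}\partial_{\eta^2}\int_0^\lambda d\gamma$, and similarly for the other integrals: $\int_{-\nabla}^0 d\Lambda=\partial_{\chi^1}\partial_{\chi^2}\int_{-\partial}^0 d\lambda$ and $\int_0^{\nabla} d\Lambda=\partial_{\chi^1}\partial_{\chi^2}\int_0^{\partial} d\lambda$. The usual sign rule applies throughout: moving an odd symbol past an odd symbol produces a minus sign. An *ideal* is a graded subspace stable under $D^1,D^2$, under left and right products with arbitrary vectors, and under taking coefficients of $\Lambda$-brackets with arbitrary vectors on either side; the quotient by an ideal is again an $N_K=2$ SUSY vertex algebra. A vector $P\in V$ is an *$N=2$ superconformal vector of central charge $c\in\mathbb C$* if $$[P\,{}_\Lambda\, P]=(2\partial+2\lambda+\chi^1D^1+\chi^2D^2)P+\tfrac c3\,\lambda\chi^1\chi^2\,|0\rangle ,$$ if for every $v\in V$ the coefficients of $1$, $\chi^1$, $\chi^2$ in $[P\,{}_\Lambda\, v]$ are $2\partial v$, $D^1v$, $D^2v$, and if the endomorphism of $V$ sending $v$ to the coefficient of $\lambda$ in $[P\,{}_\Lambda\, v]$ is diagonalizable.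 **The system.** Let $A=A_{\bar0}\sqcup A_{\bar1}$ be a homogeneous basis of a finite-dimensional vector superspace, with even part $A_{\bar0}$ and odd part $A_{\bar1}$. Let $V$ be the universal enveloping $N_K=2$ SUSY vertex algebra generated by vectors $\Phi_a$, of the parity of $a$, and $\Phi^{\bar a}$, of the opposite parity, for $a\in A$, with $$[\Phi_a\,{}_\Lambda\,\Phi^{\bar b}]=\delta_{ab}(-i\chi^1+\chi^2)|0\rangle,\qquad [\Phi_a\,{}_\Lambda\,\Phi_b]=[\Phi^{\bar a}\,{}_\Lambda\,\Phi^{\bar b}]=0 .$$ That is, for every $N_K=2$ SUSY vertex algebra $W$ with vectors of these parities satisfying these bracket relations there is a unique homomorphism $V\to W$ that sends the generators to these vectors. Let $I\subseteq V$ be the ideal generated by all $iD^1\Phi_a-D^2\Phi_a$ and $iD^1\Phi^{\bar a}-D^2\Phi^{\bar a}$. The *$N=2$ SUSY $bc$-$\beta\gamma$ system* is $V/I$. **Theorem 4.21.** For every family $(t_a)_{a\in A}$ of complex numbers, the vector $$P^{ch}_{sh}=-i\Big(\sum_{a\in A_{\bar0}}\big[(t_a+1)(D^1\Phi_a)\Phi^{\bar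 a}+t_a\,\Phi_a(D^1\Phi^{\bar a})\big]+\sum_{a\in A_{\bar1}}\big[(t_a+1)(D^1\Phi^{\bar a})\Phi_a+t_a\,\Phi^{\bar a}(D^1\Phi_a)\big]\Big)$$ of $V/I$ is an $N=2$ superconformal vector of $V/I$ of central charge $$c_{sh}=\sum_{a\in A}(6t_a+3).$$ -/

import Mathlib

universe u v

noncomputable section

namespace NK2

/-! ### Polynomials in `Λ = (λ, χ¹, χ²)` with coefficients in a vector space -/

/-- A monomial `λ^j (χ¹)^a (χ²)^b` with `a, b ∈ {0, 1}`. These monomials form a basis of the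
algebra `ℂ[λ, χ¹, χ²]` with `χⁱχʲ + χʲχⁱ = - 2 δᵢⱼ λ` and `λ` central. -/
abbrev Mon : Type := ℕ × Bool × Bool

/-- `ℂ[λ, χ¹, χ²] ⊗ V`; the coefficients in `V` are written to the right of the monomials. -/
abbrev Lam (V : Type u) [AddCommGroup V] [Module ℂ V] : Type u := Mon →₀ V

/-- The sign `(-1)^p`. -/
def sgn (p : ZMod 2) : ℂ := if p = 0 then 1 else -1

/-- The parity of a bit. -/
def bit (b : Bool) : ZMod 2 := if b then 1 else 0

/-- The parity of a monomial: `λ` is even, `χ¹` and `χ²` are odd. -/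
def Mon.parity (m : Mon) : ZMod 2 := bit m.2.1 + bit m.2.2

section Operators

variable {V : Type u} [AddCommGroup V] [Module ℂ V]
variable {W : Type v} [AddCommGroup W] [Module ℂ W]

/-- The inclusion of `V` as the constant polynomials. -/
def const : V →ₗ[ℂ] Lam V := Finsupp.lsingle (0, false, false)

/-- Left multiplication by `λ`. -/
def lam : Module.End ℂ (Lam V) :=
  Finsupp.lsum ℂ fun m => Finsupp.lsingle (m.1 + 1, m.2)

/-- Left multiplication by `χⁱ` (the index `0` stands for `χ¹`, the index `1` for `χ²`). -/
def chi : Fin 2 → Module.End ℂ (Lam V)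
  | 0 => Finsupp.lsum ℂ fun m =>
      if m.2.1 then -Finsupp.lsingle (m.1 + 1, false, m.2.2)
      else Finsupp.lsingle (m.1, true, m.2.2)
  | 1 => Finsupp.lsum ℂ fun m => sgn (bit m.2.1) •
      (if m.2.2 then -Finsupp.lsingle (m.1 + 1, m.2.1, false)
      else Finsupp.lsingle (m.1, m.2.1, true))

/-- The odd left derivative `∂/∂χⁱ`. -/
def dchi : Fin 2 → Module.End ℂ (Lam V)
  | 0 => Finsupp.lsum ℂ fun m =>
      if m.2.1 then Finsupp.lsingle (m.1, false, m.2.2) else 0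
  | 1 => Finsupp.lsum ℂ fun m => sgn (bit m.2.1) •
      (if m.2.2 then Finsupp.lsingle (m.1, m.2.1, false) else 0)

/-- The action of a linear map `T` of parity `q` on coefficients, with the Koszul sign:
`T (λ^j χ^J v) = (-1)^(q |J|) λ^j χ^J (T v)`. -/
def coefMap (q : ZMod 2) (T : V →ₗ[ℂ] W) : Lam V →ₗ[ℂ] Lam W :=
  Finsupp.lsum ℂ fun m => sgn (q * Mon.parity m) • (Finsupp.lsingle m ∘ₗ T)

/-- Substitution of operators `l, x⁰, x¹` on `W` for `λ, χ¹, χ²`, and of `e v` for `v`: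
`λ^j (χ¹)^a (χ²)^b v ↦ l^j (x⁰)^a (x¹)^b (e v)`. -/
def subst (e : V →ₗ[ℂ] W) (l : Module.End ℂ W) (x : Fin 2 → Module.End ℂ W) :
    Lam V →ₗ[ℂ] W :=
  Finsupp.lsum ℂ fun m =>
    (l ^ m.1 * (if m.2.1 then x 0 else 1) * (if m.2.2 then x 1 else 1)) ∘ₗ e

/-- The integral `∫_0^T dΛ = ∂_{χ¹} ∂_{χ²} ∫_0^T dλ`, where the resulting powers of the operator
`T` are applied to `e v`. As `∂_{χ¹} ∂_{χ²} (χ¹ χ²) = -1`, it is the map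
`λ^k χ¹ χ² v ↦ - (k+1)⁻¹ T^(k+1) (e v)`, and all monomials without `χ¹ χ²` go to `0`. -/
def integral (e : V →ₗ[ℂ] W) (T : Module.End ℂ W) : Lam V →ₗ[ℂ] W :=
  Finsupp.lsum ℂ fun m =>
    if m.2.1 && m.2.2 then (-((m.1 : ℂ) + 1)⁻¹) • ((T ^ (m.1 + 1)) ∘ₗ e) else 0

/-- The action of `Dⁱ` on `ℂ[λ, χ¹, χ²] ⊗ V`, determined by
`Dⁱ χʲ = - χʲ Dⁱ + 2 δᵢⱼ λ` and `Dⁱ λ = λ Dⁱ`. -/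
def actD (D : Fin 2 → Module.End ℂ V) (i : Fin 2) : Module.End ℂ (Lam V) :=
  coefMap 1 (D i) + (2 : ℂ) • (lam * dchi i)

/-- The substitution `Λ ↦ - ∇ - Λ = (- ∂ - λ, - D¹ - χ¹, - D² - χ²)`, where `∂ = (D¹)²`. -/
def substNeg (D : Fin 2 → Module.End ℂ V) : Lam V →ₗ[ℂ] Lam V :=
  subst const (-coefMap 0 (D 0 * D 0) - lam) fun i => -actD D i - chi i

/-! In `Lam (Lam V)` the outer variables are `Λ = (λ, χ¹, χ²)` and the inner ones are
`Γ = (γ, η¹, η²)`; the `χⁱ` anticommute with the `ηʲ`. -/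

/-- Left multiplication by `γ` on `Lam (Lam V)`. -/
def gam : Module.End ℂ (Lam (Lam V)) := coefMap 0 lam

/-- Left multiplication by `ηⁱ` on `Lam (Lam V)`. -/
def eta (i : Fin 2) : Module.End ℂ (Lam (Lam V)) := coefMap 1 (chi i)

/-- `[a _Λ ·]` on polynomials in `Γ`, for `a` of parity `p`:
`[a _Λ ηⁱ w] = (-1)^p ηⁱ [a _Λ w]` and `[a _Λ γ w] = γ [a _Λ w]`. -/
def bracketOuter (B : V →ₗ[ℂ] V →ₗ[ℂ] Lam V) (p : ZMod 2) (a : V) :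
    Lam V →ₗ[ℂ] Lam (Lam V) :=
  subst (coefMap 0 const ∘ₗ B a) gam fun i => sgn p • eta i

/-- `[b _Γ ·]` on polynomials in `Λ`, for `b` of parity `q`. -/
def bracketInner (B : V →ₗ[ℂ] V →ₗ[ℂ] Lam V) (q : ZMod 2) (b : V) :
    Lam V →ₗ[ℂ] Lam (Lam V) :=
  coefMap q (B b)

/-- `[u _{Λ+Γ} c]`. -/
def bracketAdd (B : V →ₗ[ℂ] V →ₗ[ℂ] Lam V) (c : V) : V →ₗ[ℂ] Lam (Lam V) :=
  subst (const ∘ₗ const) (lam + gam) (fun i => chi i + eta i) ∘ₗ B.flip c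

end Operators

/-- The subspace of even (`p = 0`) or odd (`p = 1`) vectors of a vector superspace, which is given
by its parity involution `σ` (the identity on even vectors, minus the identity on odd ones). -/
def homog {V : Type u} [AddCommGroup V] [Module ℂ V] (σ : Module.End ℂ V) (p : ZMod 2) :
    Submodule ℂ V :=
  Module.End.eigenspace σ (sgn p)

/-- An `N_K = 2` SUSY Lie conformal algebra structure on `V`. The operators `D 0`, `D 1` are
`D¹`, `D²`, and `∂ = (D¹)² = (D²)²`. -/
structure SUSYLieConformalAlgebra (V : Type u) [AddCommGroup V] [Module ℂ V] where
  /-- the parity involution -/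
  parity : Module.End ℂ V
  parity_mul_self : parity * parity = 1
  /-- the odd endomorphisms `D¹` and `D²` -/
  D : Fin 2 → Module.End ℂ V
  D_odd : ∀ i p, ∀ a ∈ homog parity p, D i a ∈ homog parity (p + 1)
  D_sq : D 0 * D 0 = D 1 * D 1
  D_anticomm : D 0 * D 1 + D 1 * D 0 = 0
  /-- the `Λ`-bracket -/
  bracket : V →ₗ[ℂ] V →ₗ[ℂ] Lam V
  bracket_parity : ∀ p q, ∀ a ∈ homog parity p, ∀ b ∈ homog parity q, ∀ m : Mon,
    bracket a b m ∈ homog parity (p + q + m.parity)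
  sesqui_left : ∀ i a b, bracket (D i a) b = -chi i (bracket a b)
  sesqui_right : ∀ i p, ∀ a ∈ homog parity p, ∀ b,
    bracket a (D i b) = sgn p • (actD D i (bracket a b) + chi i (bracket a b))
  skew : ∀ p q, ∀ a ∈ homog parity p, ∀ b ∈ homog parity q,
    bracket b a = -(sgn (p * q) • substNeg D (bracket a b))
  /-- `[a _Λ [b _Γ c]] = [[a _Λ b] _{Λ+Γ} c] + (-1)^{ab} [b _Γ [a _Λ c]]` -/
  jacobi : ∀ p q, ∀ a ∈ homog parity p, ∀ b ∈ homog parity q, ∀ c,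
    bracketOuter bracket p a (bracket b c) =
      subst (bracketAdd bracket c) lam chi (bracket a b) +
        sgn (p * q) • bracketInner bracket q b (bracket a c)

/-- The even derivation `∂`. -/
def SUSYLieConformalAlgebra.del {V : Type u} [AddCommGroup V] [Module ℂ V]
    (R : SUSYLieConformalAlgebra V) : Module.End ℂ V := R.D 0 * R.D 0

/-- An `N_K = 2` SUSY vertex algebra structure on `V`. -/
structure SUSYVertexAlgebra (V : Type u) [AddCommGroup V] [Module ℂ V] extends
    SUSYLieConformalAlgebra V where
  /-- the vacuum -/
  vac : V
  vac_even : vac ∈ homog parity 0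
  /-- the normally ordered product -/
  mul : V →ₗ[ℂ] V →ₗ[ℂ] V
  mul_parity : ∀ p q, ∀ a ∈ homog parity p, ∀ b ∈ homog parity q,
    mul a b ∈ homog parity (p + q)
  vac_mul : ∀ a, mul vac a = a
  mul_vac : ∀ a, mul a vac = a
  D_mul : ∀ i p, ∀ a ∈ homog parity p, ∀ b,
    D i (mul a b) = mul (D i a) b + sgn p • mul a (D i b)
  /-- `ab - (-1)^{ab} ba = ∫_{-∇}^0 [a _Λ b] dΛ` -/
  quasi_comm : ∀ p q, ∀ a ∈ homog parity p, ∀ b ∈ homog parity q,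
    mul a b - sgn (p * q) • mul b a =
      -integral LinearMap.id (-(D 0 * D 0)) (bracket a b)
  /-- `(ab)c - a(bc) = (∫_0^∇ dΛ a)[b _Λ c] + (-1)^{ab} (∫_0^∇ dΛ b)[a _Λ c]`; the powers of `∂`
  that come from the integral act on the left factor of the product. -/
  quasi_assoc : ∀ p q, ∀ a ∈ homog parity p, ∀ b ∈ homog parity q, ∀ c,
    mul (mul a b) c - mul a (mul b c) =
      integral mul.flip (LinearMap.lcomp ℂ V (D 0 * D 0)) (bracket b c) a +
        sgn (p * q) • integral mul.flip (LinearMap.lcomp ℂ V (D 0 * D 0)) (bracket a c) b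
  /-- `[a _Λ bc] = [a _Λ b]c + (-1)^{ab} b[a _Λ c] + ∫_0^Λ [[a _Λ b] _Γ c] dΓ` -/
  wick : ∀ p q, ∀ a ∈ homog parity p, ∀ b ∈ homog parity q, ∀ c,
    bracket a (mul b c) =
      coefMap 0 (mul.flip c) (bracket a b) + sgn (p * q) • coefMap q (mul b) (bracket a c) +
        subst (integral const lam ∘ₗ bracket.flip c) lam chi (bracket a b)

/-- Homomorphisms of `N_K = 2` SUSY vertex algebras. -/
structure IsHom {V : Type u} [AddCommGroup V] [Module ℂ V]
    {W : Type v} [AddCommGroup W] [Module ℂ W]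
    (𝒱 : SUSYVertexAlgebra V) (𝒲 : SUSYVertexAlgebra W) (f : V →ₗ[ℂ] W) : Prop where
  parity : ∀ a, f (𝒱.parity a) = 𝒲.parity (f a)
  D : ∀ i a, f (𝒱.D i a) = 𝒲.D i (f a)
  vac : f 𝒱.vac = 𝒲.vac
  mul : ∀ a b, f (𝒱.mul a b) = 𝒲.mul (f a) (f b)
  bracket : ∀ a b, coefMap 0 f (𝒱.bracket a b) = 𝒲.bracket (f a) (f b)

section Transport

variable {V : Type u} [AddCommGroup V] [Module ℂ V]
variable {W : Type v} [AddCommGroup W] [Module ℂ W]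

@[simp] lemma sgn_zero : sgn 0 = 1 := by simp [sgn]

lemma sgn_mul_self (p : ZMod 2) : sgn p * sgn p = 1 := by
  unfold sgn; split_ifs <;> norm_num

lemma mem_homog {σ : Module.End ℂ V} {p : ZMod 2} {a : V} :
    a ∈ homog σ p ↔ σ a = sgn p • a := by
  simp [homog]

@[simp] lemma coefMap_single (q : ZMod 2) (T : V →ₗ[ℂ] W) (m : Mon) (v : V) :
    coefMap q T (Finsupp.single m v) = sgn (q * m.parity) • Finsupp.single m (T v) := by
  simp [coefMap]

lemma coefMap_zero_apply (T : V →ₗ[ℂ] W) (x : Lam V) (m : Mon) :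
    coefMap 0 T x m = T (x m) := by
  induction x using Finsupp.induction_linear with
  | zero => simp
  | add x y hx hy => simp [hx, hy]
  | single n v =>
    by_cases h : n = m
    · subst h; simp
    · simp [Finsupp.single_eq_of_ne' h]

lemma const_apply (v : V) : const v = Finsupp.single (0, false, false) v := rfl

lemma lam_nat (f : V →ₗ[ℂ] W) (x : Lam V) : coefMap 0 f (lam x) = lam (coefMap 0 f x) := by
  induction x using Finsupp.induction_linear with
  | zero => simp
  | add x y hx hy => simp [hx, hy]
  | single n v => simp [lam]

lemma chi_nat (f : V →ₗ[ℂ] W) (i : Fin 2) (x : Lam V) :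
    coefMap 0 f (chi i x) = chi i (coefMap 0 f x) := by
  induction x using Finsupp.induction_linear with
  | zero => simp
  | add x y hx hy => simp [hx, hy]
  | single n v =>
    obtain ⟨j, a, b⟩ := n
    fin_cases i <;> cases a <;> cases b <;> simp [chi]

lemma dchi_nat (f : V →ₗ[ℂ] W) (i : Fin 2) (x : Lam V) :
    coefMap 0 f (dchi i x) = dchi i (coefMap 0 f x) := by
  induction x using Finsupp.induction_linear with
  | zero => simp
  | add x y hx hy => simp [hx, hy]
  | single n v =>
    obtain ⟨j, a, b⟩ := n
    fin_cases i <;> cases a <;> cases b <;> simp [dchi]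

lemma const_nat (f : V →ₗ[ℂ] W) (v : V) : coefMap 0 f (const v) = const (f v) := by
  simp [const_apply]

lemma coefMap_nat {V' : Type*} [AddCommGroup V'] [Module ℂ V']
    {W' : Type*} [AddCommGroup W'] [Module ℂ W'] (q : ZMod 2)
    (f : V →ₗ[ℂ] W) (g : V' →ₗ[ℂ] W') (T : V →ₗ[ℂ] V') (T' : W →ₗ[ℂ] W')
    (h : ∀ v, g (T v) = T' (f v)) (x : Lam V) :
    coefMap 0 g (coefMap q T x) = coefMap q T' (coefMap 0 f x) := by
  induction x using Finsupp.induction_linear with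
  | zero => simp
  | add x y hx hy => simp [hx, hy]
  | single n v => simp [h]

lemma subst_nat {V' : Type*} [AddCommGroup V'] [Module ℂ V']
    {W' : Type*} [AddCommGroup W'] [Module ℂ W']
    (f : V →ₗ[ℂ] W) (g : V' →ₗ[ℂ] W') (e : V →ₗ[ℂ] V') (e' : W →ₗ[ℂ] W')
    (l : Module.End ℂ V') (l' : Module.End ℂ W')
    (x : Fin 2 → Module.End ℂ V') (x' : Fin 2 → Module.End ℂ W')
    (he : ∀ v, g (e v) = e' (f v)) (hl : ∀ v, g (l v) = l' (g v))
    (hx : ∀ i v, g (x i v) = x' i (g v)) (y : Lam V) :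
    g (subst e l x y) = subst e' l' x' (coefMap 0 f y) := by
  have hpow : ∀ (n : ℕ) v, g ((l ^ n) v) = (l' ^ n) (g v) := by
    intro n
    induction n with
    | zero => simp
    | succ n ih => intro v; simp [pow_succ, ih, hl]
  induction y using Finsupp.induction_linear with
  | zero => simp
  | add x y hx hy => simp [hx, hy]
  | single n v =>
    obtain ⟨j, a, b⟩ := n
    cases a <;> cases b <;> simp [subst, hpow, hx, he]

lemma integral_nat {V' : Type*} [AddCommGroup V'] [Module ℂ V']
    {W' : Type*} [AddCommGroup W'] [Module ℂ W']
    (f : V →ₗ[ℂ] W) (g : V' →ₗ[ℂ] W') (e : V →ₗ[ℂ] V') (e' : W →ₗ[ℂ] W')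
    (l : Module.End ℂ V') (l' : Module.End ℂ W')
    (he : ∀ v, g (e v) = e' (f v)) (hl : ∀ v, g (l v) = l' (g v)) (y : Lam V) :
    g (integral e l y) = integral e' l' (coefMap 0 f y) := by
  have hpow : ∀ (n : ℕ) v, g ((l ^ n) v) = (l' ^ n) (g v) := by
    intro n
    induction n with
    | zero => simp
    | succ n ih => intro v; simp [pow_succ, ih, hl]
  induction y using Finsupp.induction_linear with
  | zero => simp
  | add x y hx hy => simp [hx, hy]
  | single n v =>
    obtain ⟨j, a, b⟩ := n
    cases a <;> cases b <;> simp [integral, hpow, he]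

lemma actD_nat (f : V →ₗ[ℂ] W) (D : Fin 2 → Module.End ℂ V) (D' : Fin 2 → Module.End ℂ W)
    (h : ∀ i v, f (D i v) = D' i (f v)) (i : Fin 2) (x : Lam V) :
    coefMap 0 f (actD D i x) = actD D' i (coefMap 0 f x) := by
  simp [actD, coefMap_nat 1 f f (D i) (D' i) (h i), lam_nat, dchi_nat]

lemma substNeg_nat (f : V →ₗ[ℂ] W) (D : Fin 2 → Module.End ℂ V) (D' : Fin 2 → Module.End ℂ W)
    (h : ∀ i v, f (D i v) = D' i (f v)) (x : Lam V) :
    coefMap 0 f (substNeg D x) = substNeg D' (coefMap 0 f x) := by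
  refine subst_nat f _ _ _ _ _ _ _ (const_nat f) ?_ ?_ x
  · intro v
    simp [coefMap_nat 0 f f (D 0 * D 0) (D' 0 * D' 0) (by simp [h]), lam_nat]
  · intro i v
    simp [actD_nat f D D' h, chi_nat]

lemma bracketOuter_nat (f : V →ₗ[ℂ] W) (B : V →ₗ[ℂ] V →ₗ[ℂ] Lam V) (B' : W →ₗ[ℂ] W →ₗ[ℂ] Lam W)
    (h : ∀ a b, coefMap 0 f (B a b) = B' (f a) (f b)) (p : ZMod 2) (a : V) (x : Lam V) :
    coefMap 0 (coefMap 0 f) (bracketOuter B p a x) =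
      bracketOuter B' p (f a) (coefMap 0 f x) := by
  refine subst_nat f _ _ _ _ _ _ _ ?_ ?_ ?_ x
  · intro v
    simp [coefMap_nat 0 f (coefMap 0 f) const const (const_nat f), h]
  · exact coefMap_nat 0 (coefMap 0 f) (coefMap 0 f) lam lam (lam_nat f)
  · intro i v
    simp [eta, coefMap_nat 1 (coefMap 0 f) (coefMap 0 f) (chi i) (chi i) (chi_nat f i)]

lemma bracketInner_nat (f : V →ₗ[ℂ] W) (B : V →ₗ[ℂ] V →ₗ[ℂ] Lam V) (B' : W →ₗ[ℂ] W →ₗ[ℂ] Lam W)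
    (h : ∀ a b, coefMap 0 f (B a b) = B' (f a) (f b)) (q : ZMod 2) (b : V) (x : Lam V) :
    coefMap 0 (coefMap 0 f) (bracketInner B q b x) =
      bracketInner B' q (f b) (coefMap 0 f x) :=
  coefMap_nat q f (coefMap 0 f) (B b) (B' (f b)) (h b) x

lemma bracketAdd_nat (f : V →ₗ[ℂ] W) (B : V →ₗ[ℂ] V →ₗ[ℂ] Lam V) (B' : W →ₗ[ℂ] W →ₗ[ℂ] Lam W)
    (h : ∀ a b, coefMap 0 f (B a b) = B' (f a) (f b)) (c u : V) :
    coefMap 0 (coefMap 0 f) (bracketAdd B c u) = bracketAdd B' (f c) (f u) := by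
  have := subst_nat f (coefMap 0 (coefMap 0 f)) (const ∘ₗ const) (const ∘ₗ const)
    (lam + gam) (lam + gam) (fun i => chi i + eta i) (fun i => chi i + eta i) ?_ ?_ ?_ (B u c)
  · simpa [bracketAdd, h] using this
  · intro v; simp [const_nat]
  · intro v
    simp [lam_nat, gam, coefMap_nat 0 (coefMap 0 f) (coefMap 0 f) lam lam (lam_nat f)]
  · intro i v
    simp [chi_nat, eta, coefMap_nat 1 (coefMap 0 f) (coefMap 0 f) (chi i) (chi i) (chi_nat f i)]

lemma lcomp_pow_apply (T : Module.End ℂ V) (n : ℕ) (g : V →ₗ[ℂ] W) (a : V) :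
    ((LinearMap.lcomp ℂ W T ^ n) g) a = g ((T ^ n) a) := by
  induction n generalizing g with
  | zero => simp
  | succ n ih => rw [pow_succ, Module.End.mul_apply, ih, LinearMap.lcomp_apply, pow_succ',
      Module.End.mul_apply]

lemma integral_flip_nat (f : V →ₗ[ℂ] W) (D : Fin 2 → Module.End ℂ V)
    (D' : Fin 2 → Module.End ℂ W) (hD : ∀ i v, f (D i v) = D' i (f v))
    (mul : V →ₗ[ℂ] V →ₗ[ℂ] V) (mul' : W →ₗ[ℂ] W →ₗ[ℂ] W)
    (hmul : ∀ a b, f (mul a b) = mul' (f a) (f b)) (x : Lam V) (a : V) :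
    f (integral mul.flip (LinearMap.lcomp ℂ V (D 0 * D 0)) x a) =
      integral mul'.flip (LinearMap.lcomp ℂ W (D' 0 * D' 0)) (coefMap 0 f x) (f a) := by
  have hpow : ∀ (n : ℕ) v, f (((D 0 * D 0) ^ n) v) = ((D' 0 * D' 0) ^ n) (f v) := by
    intro n
    induction n with
    | zero => simp
    | succ n ih => intro v; simp [pow_succ, ih, hD]
  induction x using Finsupp.induction_linear with
  | zero => simp
  | add x y hx hy => simp [hx, hy]
  | single n v =>
    obtain ⟨j, k, l⟩ := n
    cases k <;> cases l <;> simp [integral, lcomp_pow_apply, hmul, hpow]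

/-- Structure maps that correspond to those of a SUSY vertex algebra under a surjective linear map
satisfy the axioms of a SUSY vertex algebra. -/
def SUSYVertexAlgebra.ofSurjective (𝒱 : SUSYVertexAlgebra V) (f : V →ₗ[ℂ] W)
    (hf : Function.Surjective f) (σ : Module.End ℂ W) (D : Fin 2 → Module.End ℂ W)
    (B : W →ₗ[ℂ] W →ₗ[ℂ] Lam W) (vac : W) (mul : W →ₗ[ℂ] W →ₗ[ℂ] W)
    (hσ : ∀ a, f (𝒱.parity a) = σ (f a)) (hD : ∀ i a, f (𝒱.D i a) = D i (f a))
    (hB : ∀ a b, coefMap 0 f (𝒱.bracket a b) = B (f a) (f b)) (hvac : f 𝒱.vac = vac)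
    (hmul : ∀ a b, f (𝒱.mul a b) = mul (f a) (f b)) : SUSYVertexAlgebra W :=
  have hmap : ∀ {p a}, a ∈ homog 𝒱.parity p → f a ∈ homog σ p := by
    intro p a ha
    rw [mem_homog] at ha ⊢
    rw [← hσ, ha, map_smul]
  have hlift : ∀ {p a}, a ∈ homog σ p → ∃ a' ∈ homog 𝒱.parity p, f a' = a := by
    intro p a ha
    obtain ⟨a, rfl⟩ := hf a
    rw [mem_homog, ← hσ] at ha
    have hs : ∀ x, 𝒱.parity (𝒱.parity x) = x := fun x =>
      congrArg (fun T : Module.End ℂ V => T x) 𝒱.parity_mul_self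
    refine ⟨(2 : ℂ)⁻¹ • (a + sgn p • 𝒱.parity a), ?_, ?_⟩
    · rw [mem_homog]
      simp only [map_smul, map_add, hs, smul_add, smul_smul]
      rw [mul_left_comm (sgn p) _ (sgn p), sgn_mul_self, mul_comm (sgn p)]
      module
    · simp only [map_smul, map_add, ha, smul_smul, sgn_mul_self]
      module
  { parity := σ
    parity_mul_self := by
      ext w
      obtain ⟨a, rfl⟩ := hf w
      have := congrArg (fun T : Module.End ℂ V => f (T a)) 𝒱.parity_mul_self
      simpa [hσ] using this
    D := D
    D_odd := by
      intro i p a ha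
      obtain ⟨a, hha, rfl⟩ := hlift ha
      rw [← hD]
      exact hmap (𝒱.D_odd i p a hha)
    D_sq := by
      ext w
      obtain ⟨a, rfl⟩ := hf w
      have := congrArg (fun T : Module.End ℂ V => f (T a)) 𝒱.D_sq
      simpa [hD] using this
    D_anticomm := by
      ext w
      obtain ⟨a, rfl⟩ := hf w
      have := congrArg (fun T : Module.End ℂ V => f (T a)) 𝒱.D_anticomm
      simpa [hD] using this
    bracket := B
    bracket_parity := by
      intro p q a ha b hb m
      obtain ⟨a, hha, rfl⟩ := hlift ha
      obtain ⟨b, hhb, rfl⟩ := hlift hb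
      rw [← hB, coefMap_zero_apply]
      exact hmap (𝒱.bracket_parity p q a hha b hhb m)
    sesqui_left := by
      intro i a b
      obtain ⟨a, rfl⟩ := hf a
      obtain ⟨b, rfl⟩ := hf b
      rw [← hD, ← hB, ← hB, 𝒱.sesqui_left, map_neg, chi_nat]
    sesqui_right := by
      intro i p a ha b
      obtain ⟨a, hha, rfl⟩ := hlift ha
      obtain ⟨b, rfl⟩ := hf b
      rw [← hD, ← hB, ← hB, 𝒱.sesqui_right i p a hha, map_smul, map_add, chi_nat,
        actD_nat f _ D hD]
    skew := by
      intro p q a ha b hb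
      obtain ⟨a, hha, rfl⟩ := hlift ha
      obtain ⟨b, hhb, rfl⟩ := hlift hb
      rw [← hB, ← hB, 𝒱.skew p q a hha b hhb, map_neg, map_smul, substNeg_nat f _ D hD]
    jacobi := by
      intro p q a ha b hb c
      obtain ⟨a, hha, rfl⟩ := hlift ha
      obtain ⟨b, hhb, rfl⟩ := hlift hb
      obtain ⟨c, rfl⟩ := hf c
      have := congrArg (coefMap 0 (coefMap 0 f)) (𝒱.jacobi p q a hha b hhb c)
      rw [map_add, map_smul, bracketOuter_nat f _ B hB, bracketInner_nat f _ B hB, hB, hB,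
        subst_nat f (coefMap 0 (coefMap 0 f)) _ (bracketAdd B (f c)) lam lam chi chi
          (bracketAdd_nat f _ B hB c) (lam_nat _) (chi_nat _), hB] at this
      exact this
    vac := vac
    vac_even := hvac ▸ hmap 𝒱.vac_even
    mul := mul
    mul_parity := by
      intro p q a ha b hb
      obtain ⟨a, hha, rfl⟩ := hlift ha
      obtain ⟨b, hhb, rfl⟩ := hlift hb
      rw [← hmul]
      exact hmap (𝒱.mul_parity p q a hha b hhb)
    vac_mul := by
      intro a
      obtain ⟨a, rfl⟩ := hf a
      rw [← hvac, ← hmul, 𝒱.vac_mul]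
    mul_vac := by
      intro a
      obtain ⟨a, rfl⟩ := hf a
      rw [← hvac, ← hmul, 𝒱.mul_vac]
    D_mul := by
      intro i p a ha b
      obtain ⟨a, hha, rfl⟩ := hlift ha
      obtain ⟨b, rfl⟩ := hf b
      rw [← hmul, ← hD, ← hD, ← hD, ← hmul, ← hmul, 𝒱.D_mul i p a hha, map_add, map_smul]
    quasi_comm := by
      intro p q a ha b hb
      obtain ⟨a, hha, rfl⟩ := hlift ha
      obtain ⟨b, hhb, rfl⟩ := hlift hb
      have := congrArg f (𝒱.quasi_comm p q a hha b hhb)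
      rw [map_neg, integral_nat f f LinearMap.id LinearMap.id (-(𝒱.D 0 * 𝒱.D 0)) (-(D 0 * D 0))
        (by simp) (by simp [hD]), hB, map_sub, map_smul, hmul, hmul] at this
      exact this
    quasi_assoc := by
      intro p q a ha b hb c
      obtain ⟨a, hha, rfl⟩ := hlift ha
      obtain ⟨b, hhb, rfl⟩ := hlift hb
      obtain ⟨c, rfl⟩ := hf c
      have key := integral_flip_nat f 𝒱.D D hD 𝒱.mul mul hmul
      have := congrArg f (𝒱.quasi_assoc p q a hha b hhb c)
      rw [map_add, map_smul, key, key, hB, hB, map_sub, hmul, hmul, hmul, hmul] at this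
      exact this
    wick := by
      intro p q a ha b hb c
      obtain ⟨a, hha, rfl⟩ := hlift ha
      obtain ⟨b, hhb, rfl⟩ := hlift hb
      obtain ⟨c, rfl⟩ := hf c
      have := congrArg (coefMap 0 f) (𝒱.wick p q a hha b hhb c)
      rw [map_add, map_add, map_smul, hB, hmul,
        coefMap_nat 0 f f _ (mul.flip (f c)) (by simp [hmul]),
        coefMap_nat q f f _ (mul (f b)) (hmul b),
        subst_nat f (coefMap 0 f) _ (integral const lam ∘ₗ B.flip (f c)) lam lam chi chi ?_
          (lam_nat _) (chi_nat _), hB, hB] at this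
      · exact this
      · intro u
        rw [LinearMap.comp_apply, LinearMap.comp_apply, LinearMap.flip_apply,
          LinearMap.flip_apply, ← hB]
        exact integral_nat f _ _ _ _ _ (const_nat f) (lam_nat f) _ }

end Transport

section Quotient

variable {V : Type u} [AddCommGroup V] [Module ℂ V]

/-- Ideals of an `N_K = 2` SUSY vertex algebra: graded subspaces that are stable under `D¹` and
`D²`, under products with arbitrary vectors from both sides, and under taking the coefficients of
`Λ`-brackets with arbitrary vectors from both sides. -/
structure IsIdeal (𝒱 : SUSYVertexAlgebra V) (I : Submodule ℂ V) : Prop where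
  parity : ∀ x ∈ I, 𝒱.parity x ∈ I
  D : ∀ i, ∀ x ∈ I, 𝒱.D i x ∈ I
  mul_left : ∀ a, ∀ x ∈ I, 𝒱.mul a x ∈ I
  mul_right : ∀ a, ∀ x ∈ I, 𝒱.mul x a ∈ I
  bracket_left : ∀ a, ∀ x ∈ I, ∀ m, 𝒱.bracket a x m ∈ I
  bracket_right : ∀ a, ∀ x ∈ I, ∀ m, 𝒱.bracket x a m ∈ I

/-- The ideal generated by a set of vectors. -/
def idealSpan (𝒱 : SUSYVertexAlgebra V) (S : Set V) : Submodule ℂ V :=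
  sInf {I | IsIdeal 𝒱 I ∧ S ⊆ I}

lemma isIdeal_idealSpan (𝒱 : SUSYVertexAlgebra V) (S : Set V) :
    IsIdeal 𝒱 (idealSpan 𝒱 S) := by
  simp only [idealSpan]
  constructor <;> simp only [Submodule.mem_sInf, Set.mem_ofPred_eq] <;> intros
  · rename_i x h I hI; exact hI.1.parity x (h I hI)
  · rename_i i x h I hI; exact hI.1.D i x (h I hI)
  · rename_i a x h I hI; exact hI.1.mul_left a x (h I hI)
  · rename_i a x h I hI; exact hI.1.mul_right a x (h I hI)
  · rename_i a x h m I hI; exact hI.1.bracket_left a x (h I hI) m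
  · rename_i a x h m I hI; exact hI.1.bracket_right a x (h I hI) m

/-- A bilinear map that vanishes when one of its arguments lies in `I` descends to `V ⧸ I`. -/
def quotBilin {W : Type v} [AddCommGroup W] [Module ℂ W] (I : Submodule ℂ V)
    (B : V →ₗ[ℂ] V →ₗ[ℂ] W) (hl : ∀ a, ∀ x ∈ I, B a x = 0) (hr : ∀ a, ∀ x ∈ I, B x a = 0) :
    (V ⧸ I) →ₗ[ℂ] (V ⧸ I) →ₗ[ℂ] W :=
  I.liftQ (LinearMap.flip (I.liftQ B.flip fun x hx => by
    ext a; simpa using hl a x hx)) fun x hx => by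
    ext a; exact hr a x hx

@[simp] lemma quotBilin_mk {W : Type v} [AddCommGroup W] [Module ℂ W] (I : Submodule ℂ V)
    (B : V →ₗ[ℂ] V →ₗ[ℂ] W) (hl : ∀ a, ∀ x ∈ I, B a x = 0) (hr : ∀ a, ∀ x ∈ I, B x a = 0)
    (a b : V) : quotBilin I B hl hr (I.mkQ a) (I.mkQ b) = B a b := rfl

lemma coefMap_mkQ_eq_zero (I : Submodule ℂ V) (x : Lam V) (h : ∀ m, x m ∈ I) :
    coefMap 0 I.mkQ x = 0 := by
  ext m
  rw [coefMap_zero_apply]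
  simpa using h m

/-- The quotient of an `N_K = 2` SUSY vertex algebra by an ideal. -/
def SUSYVertexAlgebra.quotient (𝒱 : SUSYVertexAlgebra V) (I : Submodule ℂ V)
    (hI : IsIdeal 𝒱 I) : SUSYVertexAlgebra (V ⧸ I) :=
  𝒱.ofSurjective I.mkQ I.mkQ_surjective
    (I.mapQ I 𝒱.parity fun x hx => hI.parity x hx)
    (fun i => I.mapQ I (𝒱.D i) fun x hx => hI.D i x hx)
    (quotBilin I (𝒱.bracket.compr₂ (coefMap 0 I.mkQ))
      (fun a x hx => coefMap_mkQ_eq_zero I _ (hI.bracket_left a x hx))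
      (fun a x hx => coefMap_mkQ_eq_zero I _ (hI.bracket_right a x hx)))
    (I.mkQ 𝒱.vac)
    (quotBilin I (𝒱.mul.compr₂ I.mkQ)
      (fun a x hx => by simpa using hI.mul_left a x hx)
      (fun a x hx => by simpa using hI.mul_right a x hx))
    (fun _ => rfl) (fun _ _ => rfl) (fun _ _ => rfl) rfl (fun _ _ => rfl)

end Quotient

/-- `P` is an `N = 2` superconformal vector of central charge `c`:
`[P _Λ P] = (2∂ + 2λ + χ¹D¹ + χ²D²)P + (c/3) λχ¹χ²`, for every `v` the coefficients of
`1`, `χ¹` and `χ²` in `[P _Λ v]` are `2∂v`, `D¹v` and `D²v`, and the coefficient of `λ`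
defines a diagonalizable endomorphism `v ↦ P_{(1|00)} v`. -/
structure IsSuperconformalVector {V : Type u} [AddCommGroup V] [Module ℂ V]
    (𝒱 : SUSYVertexAlgebra V) (P : V) (c : ℂ) : Prop where
  bracket_self : 𝒱.bracket P P =
    const ((2 : ℂ) • 𝒱.del P) + lam (const ((2 : ℂ) • P)) + chi 0 (const (𝒱.D 0 P)) +
      chi 1 (const (𝒱.D 1 P)) + lam (chi 0 (chi 1 (const ((c / 3) • 𝒱.vac))))
  coeff_one : ∀ v, 𝒱.bracket P v (0, false, false) = (2 : ℂ) • 𝒱.del v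
  coeff_chi_one : ∀ v, 𝒱.bracket P v (0, true, false) = 𝒱.D 0 v
  coeff_chi_two : ∀ v, 𝒱.bracket P v (0, false, true) = 𝒱.D 1 v
  diagonalizable :
    ⨆ μ : ℂ, Module.End.eigenspace (Finsupp.lapply (1, false, false) ∘ₗ 𝒱.bracket P) μ = ⊤

section System

variable {A : Type u}

/-- Vectors `Φ_a` and `Φ^ā` (written `Φ a` and `Ψ a`), indexed by a homogeneous basis `A` of a
vector superspace with parities `par`, with the parities and the brackets of the generators of the
`N = 2` SUSY `bc`-`βγ` system. Equivalently, the images of the generators under a homomorphism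
`ℋ ⊗ (Φ_U ⊕ Φ^Ū) ⊕ ℂ → W` of SUSY Lie conformal algebras that sends `1 ∈ ℂ` to the vacuum: as the
`ℋ`-module `ℋ ⊗ (Φ_U ⊕ Φ^Ū)` is free, such a homomorphism is determined by these images, and all
other brackets follow by sesquilinearity and skew-symmetry. -/
structure IsRealization [DecidableEq A] (par : A → ZMod 2) {W : Type v} [AddCommGroup W] [Module ℂ W]
    (𝒲 : SUSYVertexAlgebra W) (Φ Ψ : A → W) : Prop where
  mem_left : ∀ a, Φ a ∈ homog 𝒲.parity (par a)
  mem_right : ∀ a, Ψ a ∈ homog 𝒲.parity (par a + 1)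
  /-- `[Φ_a _Λ Φ^b̄] = δ_ab (- i χ¹ + χ²)` -/
  bracket_left_right : ∀ a b, 𝒲.bracket (Φ a) (Ψ b) =
    if a = b then -(Complex.I • chi 0 (const 𝒲.vac)) + chi 1 (const 𝒲.vac) else 0
  bracket_left_left : ∀ a b, 𝒲.bracket (Φ a) (Φ b) = 0
  bracket_right_right : ∀ a b, 𝒲.bracket (Ψ a) (Ψ b) = 0

/-- `(V, Φ, Ψ)` is the universal enveloping `N_K = 2` SUSY vertex algebra: the generators satisfy
the prescribed brackets, and every SUSY vertex algebra with such vectors receives a unique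
homomorphism from `V` that is compatible with them. -/
structure IsUniversalEnvelope [DecidableEq A] (par : A → ZMod 2) {V : Type u} [AddCommGroup V] [Module ℂ V]
    (𝒱 : SUSYVertexAlgebra V) (Φ Ψ : A → V) : Prop where
  realization : IsRealization par 𝒱 Φ Ψ
  universal : ∀ (W : Type u) [AddCommGroup W] [Module ℂ W] (𝒲 : SUSYVertexAlgebra W)
    (x y : A → W), IsRealization par 𝒲 x y →
      ∃! f : V →ₗ[ℂ] W, IsHom 𝒱 𝒲 f ∧ (∀ a, f (Φ a) = x a) ∧ ∀ a, f (Ψ a) = y a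

/-- The relations `i D¹ Φ_a = D² Φ_a` and `i D¹ Φ^ā = D² Φ^ā`. -/
def relations {V : Type u} [AddCommGroup V] [Module ℂ V] (𝒱 : SUSYVertexAlgebra V)
    (Φ Ψ : A → V) : Set V :=
  (Set.range fun a => Complex.I • 𝒱.D 0 (Φ a) - 𝒱.D 1 (Φ a)) ∪
    Set.range fun a => Complex.I • 𝒱.D 0 (Ψ a) - 𝒱.D 1 (Ψ a)

/-- The ideal generated by the relations. -/
def relationIdeal {V : Type u} [AddCommGroup V] [Module ℂ V] (𝒱 : SUSYVertexAlgebra V)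
    (Φ Ψ : A → V) : Submodule ℂ V :=
  idealSpan 𝒱 (relations 𝒱 Φ Ψ)

/-- The `N = 2` SUSY `bc`-`βγ` system, as the quotient of the universal enveloping
SUSY vertex algebra `(V, Φ, Ψ)` by the ideal generated by the relations. -/
def bcBetaGamma {V : Type u} [AddCommGroup V] [Module ℂ V] (𝒱 : SUSYVertexAlgebra V)
    (Φ Ψ : A → V) : SUSYVertexAlgebra (V ⧸ relationIdeal 𝒱 Φ Ψ) :=
  𝒱.quotient (relationIdeal 𝒱 Φ Ψ) (isIdeal_idealSpan 𝒱 _)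

/-- The vector `- i (∑_{a even} ((t_a + 1) D¹Φ_a Φ^ā + t_a Φ_a D¹Φ^ā)
+ ∑_{a odd} ((t_a + 1) D¹Φ^ā Φ_a + t_a Φ^ā D¹Φ_a))`. -/
def shiftedVector [Fintype A] (par : A → ZMod 2) {W : Type v} [AddCommGroup W] [Module ℂ W]
    (𝒲 : SUSYVertexAlgebra W) (Φ Ψ : A → W) (t : A → ℂ) : W :=
  -(Complex.I •
    (∑ a with par a = 0, ((t a + 1) • 𝒲.mul (𝒲.D 0 (Φ a)) (Ψ a) +
        t a • 𝒲.mul (Φ a) (𝒲.D 0 (Ψ a))) +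
      ∑ a with par a = 1, ((t a + 1) • 𝒲.mul (𝒲.D 0 (Ψ a)) (Φ a) +
        t a • 𝒲.mul (Ψ a) (𝒲.D 0 (Φ a)))))

end System

/-! ### Existence of the universal envelope

The universal envelope is the quotient of the space of all words in the generators by the linear
combinations of words that vanish in every realization. -/

section Existence

/-- Formal words in the generators, the vacuum, `D¹`, `D²` and the product. -/
inductive Word (A : Type u) : Type u
  | vac : Word A
  | phi (a : A) : Word A
  | psi (a : A) : Word A
  | D (i : Fin 2) (w : Word A) : Word A
  | mul (w w' : Word A) : Word A

namespace Word

variable {A : Type u}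

/-- The number of generators in a word. -/
def deg : Word A → ℕ
  | vac => 0
  | phi _ => 1
  | psi _ => 1
  | D _ w => deg w
  | mul w w' => deg w + deg w'

/-- The length of a word. -/
def size : Word A → ℕ
  | vac => 1
  | phi _ => 1
  | psi _ => 1
  | D _ w => size w + 1
  | mul w w' => size w + size w' + 1

/-- The parity of a word. -/
def parity (par : A → ZMod 2) : Word A → ZMod 2
  | vac => 0
  | phi a => par a
  | psi a => par a + 1
  | D _ w => parity par w + 1
  | mul w w' => parity par w + parity par w'

/-- The value of a word in a SUSY vertex algebra. -/
def eval {W : Type v} [AddCommGroup W] [Module ℂ W] (𝒲 : SUSYVertexAlgebra W) (x y : A → W) :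
    Word A → W
  | vac => 𝒲.vac
  | phi a => x a
  | psi a => y a
  | D i w => 𝒲.D i (eval 𝒲 x y w)
  | mul w w' => 𝒲.mul (eval 𝒲 x y w) (eval 𝒲 x y w')

end Word

variable {A : Type u} [DecidableEq A]

/-- A realization in some SUSY vertex algebra. -/
structure Model (par : A → ZMod 2) : Type (u + 1) where
  W : Type u
  [grp : AddCommGroup W]
  [mod : Module ℂ W]
  alg : SUSYVertexAlgebra W
  x : A → W
  y : A → W
  real : IsRealization par alg x y

attribute [instance] Model.grp Model.mod

variable {par : A → ZMod 2}

/-- Linear combinations of words from a set `S`. -/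
abbrev Span (S : Set (Word A)) : Type u := S →₀ ℂ

/-- Evaluation of linear combinations of words. -/
def Model.ev (M : Model par) (S : Set (Word A)) : Span S →ₗ[ℂ] M.W :=
  Finsupp.linearCombination ℂ fun w => w.1.eval M.alg M.x M.y

/-- Evaluation of a word. -/
abbrev Model.val (M : Model par) (w : Word A) : M.W := w.eval M.alg M.x M.y

@[simp] lemma Model.ev_single (M : Model par) (S : Set (Word A)) (w : S) (z : ℂ) :
    M.ev S (Finsupp.single w z) = z • M.val w.1 := by
  simp [Model.ev]

lemma Model.val_mem (M : Model par) (w : Word A) :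
    M.val w ∈ homog M.alg.parity (w.parity par) := by
  induction w with
  | vac => exact M.alg.vac_even
  | phi a => exact M.real.mem_left a
  | psi a => exact M.real.mem_right a
  | D i w ih => exact M.alg.D_odd i _ _ ih
  | mul w w' ih ih' => exact M.alg.mul_parity _ _ _ ih _ ih'

/-- Words with at least two generators fewer than `k`. -/
def low (A : Type u) (k : ℕ) : Set (Word A) := {w | w.deg + 2 ≤ k}

/-- The linear map given by an operation on words. -/
def mapWord {S S' : Set (Word A)} (g : Word A → Word A) (h : ∀ w ∈ S, g w ∈ S') :
    Span S →ₗ[ℂ] Span S' :=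
  Finsupp.lmapDomain ℂ ℂ fun w => ⟨g w.1, h w.1 w.2⟩

/-- The bracket of two words is, in every realization, given by one polynomial in words. -/
def Rep (par : A → ZMod 2) (s t : Word A) : Prop :=
  ∃ p : Lam (Span (low A (s.deg + t.deg))), ∀ M : Model par,
    coefMap 0 (M.ev _) p = M.alg.bracket (M.val s) (M.val t)

lemma ev_mapWord (M : Model par) {S S' : Set (Word A)} (g : Word A → Word A)
    (h : ∀ w ∈ S, g w ∈ S') (T : M.W →ₗ[ℂ] M.W) (hT : ∀ w, M.val (g w) = T (M.val w))
    (v : Span S) : M.ev S' (mapWord g h v) = T (M.ev S v) := by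
  induction v using Finsupp.induction_linear with
  | zero => simp
  | add x y hx hy => simp [hx, hy]
  | single w z => simp [mapWord, Finsupp.mapDomain_single, hT]

lemma coefMap_add_apply {V : Type u} [AddCommGroup V] [Module ℂ V]
    {W : Type v} [AddCommGroup W] [Module ℂ W] (q : ZMod 2) (T T' : V →ₗ[ℂ] W) (x : Lam V) :
    coefMap q (T + T') x = coefMap q T x + coefMap q T' x := by
  induction x using Finsupp.induction_linear with
  | zero => simp
  | add x y hx hy => simp only [map_add, hx, hy]; abel
  | single n v => simp

lemma coefMap_comp_apply {V : Type u} [AddCommGroup V] [Module ℂ V]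
    {W : Type*} [AddCommGroup W] [Module ℂ W] {X : Type*} [AddCommGroup X] [Module ℂ X]
    (T : V →ₗ[ℂ] W) (T' : W →ₗ[ℂ] X) (x : Lam V) :
    coefMap 0 (T' ∘ₗ T) x = coefMap 0 T' (coefMap 0 T x) := by
  ext m; simp [coefMap_zero_apply]

/-- The operators `D¹`, `D²` on linear combinations of words. -/
def wordD (k : ℕ) (i : Fin 2) : Module.End ℂ (Span (low A k)) :=
  mapWord (Word.D i) fun _ h => h

lemma rep_skew {s t : Word A} (h : Rep par s t) : Rep par t s := by
  unfold Rep at h ⊢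
  rw [Nat.add_comm t.deg s.deg]
  obtain ⟨p, hp⟩ := h
  refine ⟨-(sgn (s.parity par * t.parity par) • substNeg (wordD _) p), fun M => ?_⟩
  rw [M.alg.skew _ _ _ (M.val_mem s) _ (M.val_mem t), map_neg, map_smul,
    substNeg_nat (M.ev _) _ M.alg.D, hp]
  intro i v
  exact ev_mapWord M _ _ (M.alg.D i) (fun _ => rfl) v

lemma rep_D {s t : Word A} (i : Fin 2) (h : Rep par s t) : Rep par (Word.D i s) t := by
  obtain ⟨p, hp⟩ := h
  refine ⟨-chi i p, fun M => ?_⟩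
  exact (by rw [map_neg, chi_nat, hp, ← M.alg.sesqui_left]; rfl :
    coefMap 0 (M.ev (low A (s.deg + t.deg))) (-chi i p) =
      M.alg.bracket (M.val (Word.D i s)) (M.val t))

lemma chi_injective {V : Type u} [AddCommGroup V] [Module ℂ V] (x : Lam V)
    (h : chi 0 x = 0) : x = 0 := by
  have key : ∀ x : Lam V, ∀ j b, chi 0 x (j, true, b) = x (j, false, b) ∧
      chi 0 x (j + 1, false, b) = - x (j, true, b) := by
    intro x j b
    induction x using Finsupp.induction_linear with
    | zero => simp
    | add x y hx hy => simp [hx, hy, add_comm]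
    | single n v =>
      obtain ⟨j', a', b'⟩ := n
      cases a' <;> simp [chi, Finsupp.single_apply]
  ext ⟨j, a, b⟩
  cases a
  · rw [← (key x j b).1, h]; rfl
  · rw [← neg_inj, ← (key x j b).2, h]; simp

lemma D_vac {V : Type u} [AddCommGroup V] [Module ℂ V] (𝒱 : SUSYVertexAlgebra V) (i : Fin 2) :
    𝒱.D i 𝒱.vac = 0 := by
  have := 𝒱.D_mul i 0 _ 𝒱.vac_even 𝒱.vac
  simpa [𝒱.vac_mul, 𝒱.mul_vac] using this

lemma rep_vac (t : Word A) : Rep par Word.vac t := by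
  refine ⟨0, fun M => ?_⟩
  rw [map_zero]
  symm
  apply chi_injective
  have := M.alg.sesqui_left 0 M.alg.vac (M.val t)
  rw [D_vac] at this
  change chi 0 (M.alg.bracket M.alg.vac (M.val t)) = 0
  simpa using this.symm

/-- A function on words extended linearly. -/
def extend {S : Set (Word A)} {X : Type*} [AddCommGroup X] [Module ℂ X] (g : S → X) :
    Span S →ₗ[ℂ] X := Finsupp.linearCombination ℂ g

/-- Enlarging the set of words. -/
def incl {S S' : Set (Word A)} (h : S ⊆ S') : Span S →ₗ[ℂ] Span S' := mapWord id h

lemma ev_incl (M : Model par) {S S' : Set (Word A)} (h : S ⊆ S') (v : Span S) :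
    M.ev S' (incl h v) = M.ev S v :=
  ev_mapWord M id h LinearMap.id (fun _ => rfl) v

lemma rep_mul {s t t' : Word A} (h : Rep par s t) (h' : Rep par s t')
    (hlow : ∀ c ∈ low A (s.deg + t.deg), Rep par c t') :
    Rep par s (Word.mul t t') := by
  obtain ⟨p, hp⟩ := h
  obtain ⟨r, hr⟩ := h'
  choose g hg using hlow
  set k := s.deg + (Word.mul t t').deg with hk
  have hk' : k = s.deg + t.deg + t'.deg := by simp [hk, Word.deg, add_assoc]
  let R : Span (low A (s.deg + t.deg)) →ₗ[ℂ] Span (low A k) :=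
    mapWord (fun w => Word.mul w t') fun w hw => by
      simp only [low, Set.mem_ofPred_eq, Word.deg] at hw ⊢; omega
  let L : Span (low A (s.deg + t'.deg)) →ₗ[ℂ] Span (low A k) :=
    mapWord (fun w => Word.mul t w) fun w hw => by
      simp only [low, Set.mem_ofPred_eq, Word.deg] at hw ⊢; omega
  have hsub : ∀ c : low A (s.deg + t.deg), low A (c.1.deg + t'.deg) ⊆ low A k := by
    intro c w hw
    have := c.2
    simp only [low, Set.mem_ofPred_eq] at hw this ⊢; omega
  let Q : Span (low A (s.deg + t.deg)) →ₗ[ℂ] Lam (Span (low A k)) :=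
    extend fun c => integral const lam (coefMap 0 (incl (hsub c)) (g c.1 c.2))
  refine ⟨coefMap 0 R p + sgn (s.parity par * t.parity par) • coefMap (t.parity par) L r +
    subst Q lam chi p, fun M => ?_⟩
  have hR : ∀ v, M.ev _ (R v) = M.alg.mul.flip (M.val t') (M.ev _ v) :=
    ev_mapWord M _ _ _ fun _ => rfl
  have hL : ∀ v, M.ev _ (L v) = M.alg.mul (M.val t) (M.ev _ v) :=
    ev_mapWord M _ _ _ fun _ => rfl
  have hQ : ∀ v, coefMap 0 (M.ev _) (Q v) =
      (integral const lam ∘ₗ M.alg.bracket.flip (M.val t')) (M.ev _ v) := by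
    intro v
    induction v using Finsupp.induction_linear with
    | zero => simp
    | add x y hx hy => rw [map_add, map_add, hx, hy, map_add, map_add]
    | single c z =>
      have e1 := integral_nat (M.ev (low A k)) (coefMap 0 (M.ev (low A k))) const const lam lam
        (const_nat _) (lam_nat _) (coefMap 0 (incl (hsub c)) (g c.1 c.2))
      have e2 : coefMap 0 (M.ev (low A k)) (coefMap 0 (incl (hsub c)) (g c.1 c.2)) =
          coefMap 0 (M.ev _) (g c.1 c.2) := by
        ext m; simp only [coefMap_zero_apply, ev_incl]
      rw [e2, hg] at e1
      simp only [Q, extend, Finsupp.linearCombination_single, map_smul, Model.ev_single, e1]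
      rfl
  rw [map_add, map_add, map_smul, coefMap_nat 0 _ _ _ _ hR, coefMap_nat _ _ _ _ _ hL,
    subst_nat (M.ev _) _ Q _ lam lam chi chi hQ (lam_nat _) (chi_nat _), hp, hr]
  exact (M.alg.wick _ _ _ (M.val_mem s) _ (M.val_mem t) _).symm

lemma rep_of {s t : Word A} (k : ℕ) (hk : s.deg + t.deg = k) (p : Lam (Span (low A k)))
    (hp : ∀ M : Model par, coefMap 0 (M.ev _) p = M.alg.bracket (M.val s) (M.val t)) :
    Rep par s t := by
  subst hk; exact ⟨p, hp⟩

lemma rep_phi_psi (a b : A) : Rep par (Word.phi a) (Word.psi b) := by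
  let o : Span (low A 2) := Finsupp.single ⟨Word.vac, by simp [low, Word.deg]⟩ 1
  refine rep_of 2 rfl
    (if a = b then -(Complex.I • chi 0 (const o)) + chi 1 (const o) else 0) fun M => ?_
  refine Eq.trans ?_ (M.real.bracket_left_right a b).symm
  have ho : M.ev (low A 2) o = M.alg.vac := by
    simp only [o, Model.ev_single, one_smul]; rfl
  split_ifs
  · simp only [map_add, map_neg, map_smul, chi_nat, const_nat, ho]
  · simp

lemma rep_all (s t : Word A) : Rep par s t := by
  obtain ⟨N, hN⟩ : ∃ N, s.deg + t.deg ≤ N := ⟨_, le_rfl⟩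
  induction N using Nat.strong_induction_on generalizing s t with
  | _ N ihN =>
  obtain ⟨k, hk⟩ : ∃ k, s.size + t.size ≤ k := ⟨_, le_rfl⟩
  induction k using Nat.strong_induction_on generalizing s t with
  | _ k ihk =>
  have step : ∀ s t t' : Word A, s.deg + (Word.mul t t').deg ≤ N →
      s.size + (Word.mul t t').size ≤ k → Rep par s (Word.mul t t') := by
    intro s t t' h1 h2
    simp only [Word.deg, Word.size] at h1 h2
    exact rep_mul (ihk (s.size + t.size) (by omega) s t (by omega) le_rfl)
      (ihk (s.size + t'.size) (by omega) s t' (by omega) le_rfl)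
      fun c hc => by
        have hc2 : c.deg + 2 ≤ s.deg + t.deg := hc
        exact ihN (c.deg + t'.deg) (by omega) c t' le_rfl
  have stepD : ∀ (i : Fin 2) (s t : Word A), (Word.D i s).deg + t.deg ≤ N →
      (Word.D i s).size + t.size ≤ k → Rep par (Word.D i s) t := by
    intro i s t h1 h2
    simp only [Word.deg, Word.size] at h1 h2
    exact rep_D i (ihk (s.size + t.size) (by omega) s t (by omega) le_rfl)
  cases s with
  | vac => exact rep_vac t
  | D i s => exact stepD i s t hN hk
  | mul s s' => exact rep_skew (step t s s' (by omega) (by omega))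
  | phi a =>
    cases t with
    | vac => exact rep_skew (rep_vac _)
    | D i t => exact rep_skew (stepD i t _ (by omega) (by omega))
    | mul t t' => exact step _ t t' hN hk
    | phi b => exact ⟨0, fun M => by rw [map_zero]; exact (M.real.bracket_left_left a b).symm⟩
    | psi b => exact rep_phi_psi a b
  | psi a =>
    cases t with
    | vac => exact rep_skew (rep_vac _)
    | D i t => exact rep_skew (stepD i t _ (by omega) (by omega))
    | mul t t' => exact step _ t t' hN hk
    | phi b => exact rep_skew (rep_phi_psi b a)
    | psi b => exact ⟨0, fun M => by rw [map_zero]; exact (M.real.bracket_right_right a b).symm⟩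

/-- Structure maps that correspond to those of SUSY vertex algebras under a jointly injective
family of linear maps satisfy the axioms of a SUSY vertex algebra. -/
def SUSYVertexAlgebra.ofInjective {ι : Type v} {V : Type u} [AddCommGroup V] [Module ℂ V]
    (W : ι → Type u) [∀ n, AddCommGroup (W n)] [∀ n, Module ℂ (W n)]
    (𝒲 : ∀ n, SUSYVertexAlgebra (W n)) (f : ∀ n, V →ₗ[ℂ] W n)
    (hf : ∀ x, (∀ n, f n x = 0) → x = 0) (σ : Module.End ℂ V) (D : Fin 2 → Module.End ℂ V)
    (B : V →ₗ[ℂ] V →ₗ[ℂ] Lam V) (vac : V) (mul : V →ₗ[ℂ] V →ₗ[ℂ] V)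
    (hσ : ∀ n a, f n (σ a) = (𝒲 n).parity (f n a))
    (hD : ∀ n i a, f n (D i a) = (𝒲 n).D i (f n a))
    (hB : ∀ n a b, coefMap 0 (f n) (B a b) = (𝒲 n).bracket (f n a) (f n b))
    (hvac : ∀ n, f n vac = (𝒲 n).vac)
    (hmul : ∀ n a b, f n (mul a b) = (𝒲 n).mul (f n a) (f n b)) : SUSYVertexAlgebra V :=
  have inj : ∀ x y, (∀ n, f n x = f n y) → x = y := fun x y h =>
    sub_eq_zero.mp (hf _ fun n => by rw [map_sub, h, sub_self])
  have injL : ∀ x y : Lam V, (∀ n, coefMap 0 (f n) x = coefMap 0 (f n) y) → x = y := by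
    intro x y h
    ext m
    refine inj _ _ fun n => ?_
    rw [← coefMap_zero_apply, h, coefMap_zero_apply]
  have injLL : ∀ x y : Lam (Lam V),
      (∀ n, coefMap 0 (coefMap 0 (f n)) x = coefMap 0 (coefMap 0 (f n)) y) → x = y := by
    intro x y h
    ext1 m
    refine injL _ _ fun n => ?_
    rw [← coefMap_zero_apply, h, coefMap_zero_apply]
  have hmap : ∀ n {p a}, a ∈ homog σ p → f n a ∈ homog (𝒲 n).parity p := by
    intro n p a ha
    rw [mem_homog] at ha ⊢
    rw [← hσ, ha, map_smul]
  have hmem : ∀ {p a}, (∀ n, f n a ∈ homog (𝒲 n).parity p) → a ∈ homog σ p := by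
    intro p a ha
    rw [mem_homog]
    refine inj _ _ fun n => ?_
    rw [hσ, map_smul]
    exact mem_homog.mp (ha n)
  { parity := σ
    parity_mul_self := by
      ext a
      refine inj _ _ fun n => ?_
      have := congrArg (fun T : Module.End ℂ (W n) => T (f n a)) (𝒲 n).parity_mul_self
      simpa [hσ] using this
    D := D
    D_odd := fun i p a ha => hmem fun n => by
      rw [hD]
      exact (𝒲 n).D_odd i p _ (hmap n ha)
    D_sq := by
      ext a
      refine inj _ _ fun n => ?_
      have := congrArg (fun T : Module.End ℂ (W n) => T (f n a)) (𝒲 n).D_sq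
      simpa [hD] using this
    D_anticomm := by
      ext a
      refine inj _ _ fun n => ?_
      have := congrArg (fun T : Module.End ℂ (W n) => T (f n a)) (𝒲 n).D_anticomm
      simpa [hD] using this
    bracket := B
    bracket_parity := fun p q a ha b hb m => hmem fun n => by
      rw [← coefMap_zero_apply, hB]
      exact (𝒲 n).bracket_parity p q _ (hmap n ha) _ (hmap n hb) m
    sesqui_left := fun i a b => injL _ _ fun n => by
      rw [hB, hD, (𝒲 n).sesqui_left, map_neg, chi_nat, hB]
    sesqui_right := fun i p a ha b => injL _ _ fun n => by
      rw [hB, hD, (𝒲 n).sesqui_right i p _ (hmap n ha), map_smul, map_add, chi_nat,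
        actD_nat (f n) D _ (hD n), hB]
    skew := fun p q a ha b hb => injL _ _ fun n => by
      rw [hB, (𝒲 n).skew p q _ (hmap n ha) _ (hmap n hb), map_neg, map_smul,
        substNeg_nat (f n) D _ (hD n), hB]
    jacobi := fun p q a ha b hb c => injLL _ _ fun n => by
      rw [map_add, map_smul, bracketOuter_nat (f n) B _ (hB n),
        bracketInner_nat (f n) B _ (hB n),
        subst_nat (f n) (coefMap 0 (coefMap 0 (f n))) _ (bracketAdd (𝒲 n).bracket (f n c))
          lam lam chi chi (bracketAdd_nat (f n) B _ (hB n) c) (lam_nat _) (chi_nat _),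
        hB, hB, hB]
      exact (𝒲 n).jacobi p q _ (hmap n ha) _ (hmap n hb) _
    vac := vac
    vac_even := hmem fun n => by rw [hvac]; exact (𝒲 n).vac_even
    mul := mul
    mul_parity := fun p q a ha b hb => hmem fun n => by
      rw [hmul]
      exact (𝒲 n).mul_parity p q _ (hmap n ha) _ (hmap n hb)
    vac_mul := fun a => inj _ _ fun n => by rw [hmul, hvac, (𝒲 n).vac_mul]
    mul_vac := fun a => inj _ _ fun n => by rw [hmul, hvac, (𝒲 n).mul_vac]
    D_mul := fun i p a ha b => inj _ _ fun n => by
      simp only [map_add, map_smul, hD, hmul]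
      exact (𝒲 n).D_mul i p _ (hmap n ha) _
    quasi_comm := fun p q a ha b hb => inj _ _ fun n => by
      rw [map_neg, integral_nat (f n) (f n) LinearMap.id LinearMap.id (-(D 0 * D 0))
        (-((𝒲 n).D 0 * (𝒲 n).D 0)) (by simp) (by simp [hD]), hB, map_sub, map_smul, hmul, hmul]
      exact (𝒲 n).quasi_comm p q _ (hmap n ha) _ (hmap n hb)
    quasi_assoc := fun p q a ha b hb c => inj _ _ fun n => by
      rw [map_add, map_smul, integral_flip_nat (f n) D _ (hD n) mul _ (hmul n),
        integral_flip_nat (f n) D _ (hD n) mul _ (hmul n), hB, hB, map_sub, hmul, hmul, hmul, hmul]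
      exact (𝒲 n).quasi_assoc p q _ (hmap n ha) _ (hmap n hb) _
    wick := fun p q a ha b hb c => injL _ _ fun n => by
      rw [map_add, map_add, map_smul, hB, hmul,
        coefMap_nat 0 (f n) (f n) _ ((𝒲 n).mul.flip (f n c)) (by simp [hmul]),
        coefMap_nat q (f n) (f n) _ ((𝒲 n).mul (f n b)) (hmul n b),
        subst_nat (f n) (coefMap 0 (f n)) _
          (integral const lam ∘ₗ (𝒲 n).bracket.flip (f n c)) lam lam chi chi ?_
          (lam_nat _) (chi_nat _), hB, hB]
      · exact (𝒲 n).wick p q _ (hmap n ha) _ (hmap n hb) _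
      · intro u
        rw [LinearMap.comp_apply, LinearMap.comp_apply, LinearMap.flip_apply,
          LinearMap.flip_apply, ← hB]
        exact integral_nat (f n) _ _ _ _ _ (const_nat (f n)) (lam_nat (f n)) _ }

/-- The space of all linear combinations of words. -/
abbrev Words (A : Type u) : Type u := Span (Set.univ : Set (Word A))

/-- A word as a vector. -/
def ofWord (w : Word A) : Words A := Finsupp.single ⟨w, Set.mem_univ w⟩ 1

/-- The combinations of words that vanish in every realization. -/
def vanishing (par : A → ZMod 2) : Submodule ℂ (Words A) :=
  ⨅ M : Model par, LinearMap.ker (M.ev Set.univ)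

lemma mem_vanishing (x : Words A) :
    x ∈ vanishing par ↔ ∀ M : Model par, M.ev Set.univ x = 0 := by
  simp [vanishing]

/-- The product of words. -/
def mulWords : Words A →ₗ[ℂ] Words A →ₗ[ℂ] Words A :=
  extend fun s => mapWord (S' := Set.univ) (Word.mul s.1) fun _ _ => Set.mem_univ _

/-- The bracket of words. -/
def bracketWords (par : A → ZMod 2) : Words A →ₗ[ℂ] Words A →ₗ[ℂ] Lam (Words A) :=
  extend fun s => extend fun t =>
    coefMap 0 (incl (Set.subset_univ _)) (rep_all (par := par) s.1 t.1).choose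

/-- The parity involution on words. -/
def parityWords (par : A → ZMod 2) : Module.End ℂ (Words A) :=
  extend fun w => sgn (w.1.parity par) • ofWord w.1

/-- The operators `D¹`, `D²` on words. -/
def DWords (i : Fin 2) : Module.End ℂ (Words A) := mapWord (Word.D i) fun _ _ => Set.mem_univ _

lemma ev_mulWords (M : Model par) (x y : Words A) :
    M.ev _ (mulWords x y) = M.alg.mul (M.ev _ x) (M.ev _ y) := by
  induction x using Finsupp.induction_linear with
  | zero => simp
  | add x x' hx hx' => simp [hx, hx']
  | single s z =>
    simp only [mulWords, extend, Finsupp.linearCombination_single, LinearMap.smul_apply, map_smul,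
      Model.ev_single]
    rw [ev_mapWord M (Word.mul s.1) _ (M.alg.mul (M.val s.1)) fun _ => rfl]

lemma ev_bracketWords (M : Model par) (x y : Words A) :
    coefMap 0 (M.ev _) (bracketWords par x y) = M.alg.bracket (M.ev _ x) (M.ev _ y) := by
  induction x using Finsupp.induction_linear with
  | zero => simp
  | add x x' hx hx' => simp only [map_add, LinearMap.add_apply, hx, hx']
  | single s z =>
    induction y using Finsupp.induction_linear with
    | zero => simp
    | add y y' hy hy' => simp only [map_add, hy, hy']
    | single t z' =>
      have h := (rep_all (par := par) s.1 t.1).choose_spec M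
      have h2 : coefMap 0 (M.ev Set.univ) (coefMap 0 (incl (Set.subset_univ _))
          (rep_all (par := par) s.1 t.1).choose) = M.alg.bracket (M.val s.1) (M.val t.1) := by
        rw [← h]
        ext m
        simp only [coefMap_zero_apply, ev_incl]
      simp only [bracketWords, extend, Finsupp.linearCombination_single, LinearMap.smul_apply,
        map_smul, Model.ev_single, h2]
      rw [smul_comm]

lemma ev_parityWords (M : Model par) (x : Words A) :
    M.ev _ (parityWords par x) = M.alg.parity (M.ev _ x) := by
  induction x using Finsupp.induction_linear with
  | zero => simp
  | add x x' hx hx' => simp [hx, hx']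
  | single s z =>
    simp only [parityWords, extend, Finsupp.linearCombination_single, map_smul, Model.ev_single,
      ofWord, one_smul, mem_homog.mp (M.val_mem s.1)]

lemma ev_DWords (M : Model par) (i : Fin 2) (x : Words A) :
    M.ev _ (DWords i x) = M.alg.D i (M.ev _ x) :=
  ev_mapWord M _ _ (M.alg.D i) (fun _ => rfl) x

/-- The underlying space of the universal envelope. -/
abbrev Envelope (par : A → ZMod 2) : Type u := Words A ⧸ vanishing par

/-- Evaluation of the universal envelope in a realization. -/
def evEnvelope (M : Model par) : Envelope par →ₗ[ℂ] M.W :=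
  (vanishing par).liftQ (M.ev _) fun x hx => (mem_vanishing x).mp hx M

@[simp] lemma evEnvelope_mk (M : Model par) (x : Words A) :
    evEnvelope M ((vanishing par).mkQ x) = M.ev _ x := rfl

lemma coefMap_evEnvelope (M : Model par) (x : Lam (Words A)) :
    coefMap 0 (evEnvelope M) (coefMap 0 (vanishing par).mkQ x) = coefMap 0 (M.ev _) x := by
  ext m
  simp only [coefMap_zero_apply, evEnvelope_mk]

/-- The universal enveloping SUSY vertex algebra. -/
def envelope (par : A → ZMod 2) : SUSYVertexAlgebra (Envelope par) :=
  SUSYVertexAlgebra.ofInjective (fun M : Model par => M.W) (fun M => M.alg) evEnvelope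
    (fun x h => by
      obtain ⟨x, rfl⟩ := (vanishing par).mkQ_surjective x
      rw [Submodule.mkQ_apply, Submodule.Quotient.mk_eq_zero, mem_vanishing]
      exact h)
    ((vanishing par).mapQ _ (parityWords par) fun x hx => by
      rw [Submodule.mem_comap, mem_vanishing]
      intro M
      rw [ev_parityWords, (mem_vanishing x).mp hx M, map_zero])
    (fun i => (vanishing par).mapQ _ (DWords i) fun x hx => by
      rw [Submodule.mem_comap, mem_vanishing]
      intro M
      rw [ev_DWords, (mem_vanishing x).mp hx M, map_zero])
    (quotBilin _ ((bracketWords par).compr₂ (coefMap 0 (vanishing par).mkQ))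
      (fun a x hx => coefMap_mkQ_eq_zero _ _ fun m => by
        rw [mem_vanishing]
        intro M
        rw [← coefMap_zero_apply, ev_bracketWords, (mem_vanishing x).mp hx M]
        simp)
      (fun a x hx => coefMap_mkQ_eq_zero _ _ fun m => by
        rw [mem_vanishing]
        intro M
        rw [← coefMap_zero_apply, ev_bracketWords, (mem_vanishing x).mp hx M]
        simp))
    ((vanishing par).mkQ (ofWord Word.vac))
    (quotBilin _ (mulWords.compr₂ (vanishing par).mkQ)
      (fun a x hx => by
        rw [LinearMap.compr₂_apply, Submodule.mkQ_apply, Submodule.Quotient.mk_eq_zero,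
          mem_vanishing]
        intro M
        rw [ev_mulWords, (mem_vanishing x).mp hx M, map_zero])
      (fun a x hx => by
        rw [LinearMap.compr₂_apply, Submodule.mkQ_apply, Submodule.Quotient.mk_eq_zero,
          mem_vanishing]
        intro M
        rw [ev_mulWords, (mem_vanishing x).mp hx M, map_zero, LinearMap.zero_apply]))
    (fun M a => by
      obtain ⟨a, rfl⟩ := (vanishing par).mkQ_surjective a
      exact ev_parityWords M a)
    (fun M i a => by
      obtain ⟨a, rfl⟩ := (vanishing par).mkQ_surjective a
      exact ev_DWords M i a)
    (fun M a b => by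
      obtain ⟨a, rfl⟩ := (vanishing par).mkQ_surjective a
      obtain ⟨b, rfl⟩ := (vanishing par).mkQ_surjective b
      exact (coefMap_evEnvelope M _).trans (ev_bracketWords M a b))
    (fun M => by
      change M.ev _ (ofWord Word.vac) = _
      simp only [ofWord, Model.ev_single, one_smul]
      rfl)
    (fun M a b => by
      obtain ⟨a, rfl⟩ := (vanishing par).mkQ_surjective a
      obtain ⟨b, rfl⟩ := (vanishing par).mkQ_surjective b
      exact ev_mulWords M a b)

/-- A word as a vector of the universal envelope. -/
def wordClass (par : A → ZMod 2) (w : Word A) : Envelope par := (vanishing par).mkQ (ofWord w)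

lemma evEnvelope_wordClass (M : Model par) (w : Word A) :
    evEnvelope M (wordClass par w) = M.val w := by
  change M.ev _ (ofWord w) = _
  simp only [ofWord, Model.ev_single, one_smul]

lemma envelope_inj {x y : Envelope par} (h : ∀ M, evEnvelope M x = evEnvelope M y) : x = y := by
  rw [← sub_eq_zero]
  obtain ⟨z, hz⟩ := (vanishing par).mkQ_surjective (x - y)
  rw [← hz, Submodule.mkQ_apply, Submodule.Quotient.mk_eq_zero, mem_vanishing]
  intro M
  rw [← evEnvelope_mk, hz, map_sub, h, sub_self]

lemma envelope_injL {x y : Lam (Envelope par)}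
    (h : ∀ M, coefMap 0 (evEnvelope M) x = coefMap 0 (evEnvelope M) y) : x = y := by
  ext1 m
  refine envelope_inj fun M => ?_
  rw [← coefMap_zero_apply, h, coefMap_zero_apply]

lemma isHom_evEnvelope (M : Model par) : IsHom (envelope par) M.alg (evEnvelope M) where
  parity a := by
    obtain ⟨a, rfl⟩ := (vanishing par).mkQ_surjective a
    exact ev_parityWords M a
  D i a := by
    obtain ⟨a, rfl⟩ := (vanishing par).mkQ_surjective a
    exact ev_DWords M i a
  vac := evEnvelope_wordClass M Word.vac
  mul a b := by
    obtain ⟨a, rfl⟩ := (vanishing par).mkQ_surjective a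
    obtain ⟨b, rfl⟩ := (vanishing par).mkQ_surjective b
    exact ev_mulWords M a b
  bracket a b := by
    obtain ⟨a, rfl⟩ := (vanishing par).mkQ_surjective a
    obtain ⟨b, rfl⟩ := (vanishing par).mkQ_surjective b
    exact (coefMap_evEnvelope M _).trans (ev_bracketWords M a b)

lemma isRealization_envelope (par : A → ZMod 2) : IsRealization par (envelope par)
    (fun a => wordClass par (Word.phi a)) (fun a => wordClass par (Word.psi a)) := by
  have hpar : ∀ w, wordClass par w ∈ homog (envelope par).parity (w.parity par) := by
    intro w
    rw [mem_homog]
    refine envelope_inj fun M => ?_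
    rw [(isHom_evEnvelope M).parity, map_smul, evEnvelope_wordClass]
    exact mem_homog.mp (M.val_mem w)
  have hbr : ∀ (w w' : Word A) (p : Lam (Envelope par)),
      (∀ M : Model par, M.alg.bracket (M.val w) (M.val w') = coefMap 0 (evEnvelope M) p) →
      (envelope par).bracket (wordClass par w) (wordClass par w') = p := by
    intro w w' p h
    refine envelope_injL fun M => ?_
    rw [(isHom_evEnvelope M).bracket, evEnvelope_wordClass, evEnvelope_wordClass, h]
  constructor
  · exact fun a => hpar (Word.phi a)
  · exact fun a => hpar (Word.psi a)
  · intro a b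
    refine hbr (Word.phi a) (Word.psi b) _ fun M => ?_
    refine (M.real.bracket_left_right a b).trans ?_
    split_ifs
    · simp only [map_add, map_neg, map_smul, chi_nat, const_nat, (isHom_evEnvelope M).vac]
    · rw [map_zero]
  · intro a b
    refine hbr (Word.phi a) (Word.phi b) _ fun M => ?_
    rw [map_zero]
    exact M.real.bracket_left_left a b
  · intro a b
    refine hbr (Word.psi a) (Word.psi b) _ fun M => ?_
    rw [map_zero]
    exact M.real.bracket_right_right a b

/-- The universal enveloping SUSY vertex algebra exists. -/
theorem isUniversalEnvelope_envelope (par : A → ZMod 2) : IsUniversalEnvelope par (envelope par)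
    (fun a => wordClass par (Word.phi a)) (fun a => wordClass par (Word.psi a)) := by
  refine ⟨isRealization_envelope par, fun W _ _ 𝒲 x y h => ?_⟩
  let M : Model par := ⟨W, 𝒲, x, y, h⟩
  refine ⟨evEnvelope M, ⟨isHom_evEnvelope M, fun a => evEnvelope_wordClass M _,
    fun a => evEnvelope_wordClass M _⟩, ?_⟩
  rintro f ⟨hf, hx, hy⟩
  have hw : ∀ w, f (wordClass par w) = M.val w := by
    intro w
    induction w with
    | vac => exact hf.vac
    | phi a => exact hx a
    | psi a => exact hy a
    | D i w ih =>
      have : wordClass par (Word.D i w) = (envelope par).D i (wordClass par w) := by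
        refine envelope_inj fun M => ?_
        rw [(isHom_evEnvelope M).D, evEnvelope_wordClass, evEnvelope_wordClass]
        rfl
      rw [this, hf.D, ih]
      rfl
    | mul w w' ih ih' =>
      have : wordClass par (Word.mul w w') =
          (envelope par).mul (wordClass par w) (wordClass par w') := by
        refine envelope_inj fun M => ?_
        rw [(isHom_evEnvelope M).mul, evEnvelope_wordClass, evEnvelope_wordClass,
          evEnvelope_wordClass]
        rfl
      rw [this, hf.mul, ih, ih']
      rfl
  ext w
  exact (hw w.1).trans (evEnvelope_wordClass M w.1).symm

end Existence

end NK2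

end

/-! For even `a` put X_a = Φ_a, Y_a = Φ^ā, and for odd `a` exchange the two. Then every X_a is even,
every Y_a is odd, and [X_a _Λ Y_b] = δ_ab(-iχ¹ + χ²)|0⟩ in all cases, because this pairing is
symmetric under skew-symmetry. Both sums in the definition of P become the single expression -i ∑
((t_a+1)(D¹X_a)Y_a + t_a X_a(D¹Y_a)), and in the quotient D² = iD¹ on all X_a and Y_a.

Every contraction of a generator with a factor of P is zero or a multiple of the vacuum, so the Wick
formula gives [X_a _Λ P] and [Y_a _Λ P] without integral terms. Skew-symmetry turns them into [P _Λ
v] = (2∂ + χ¹D¹ + χ²D² + w(λ - iχ¹χ²))v, with w = -t_a for v = X_a and w = t_a + 1 for v = Y_a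
(`chiralVector_bracket_even`, `chiralVector_bracket_odd`). A second use of the Wick formula, now
with its integral term, gives the brackets of P with the two quadratic monomials. Each has anomalous
terms in λχ¹, λχ², λ² and λχ¹χ². In the combination with coefficients t_a+1 and t_a the first three
cancel, and the last leaves i((t_a+1)² - t_a²) = i(2t_a+1). The prefactor -i makes this 2t_a+1, and
c/3 is the sum over `a` (`chiralVector_bracket_self`).

The remaining conditions concern all vectors. Call v a weight vector if the coefficients of 1, χ¹,
χ² in [P _Λ v] are 2∂v, D¹v, D²v and that of λ is a multiple of v. The vacuum and the generators are
weight vectors; each Dⁱ raises the weight by 1, and products with a homogeneous left factor add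
weights (`IsWeightVector.D`, `IsWeightVector.mul`). So every word in the generators is a weight
vector. Words span the universal envelope (`IsUniversalEnvelope.span_eval`), hence also its
quotient. Linearity then gives the three coefficient conditions, and a spanning set of eigenvectors
gives diagonalizability. -/

noncomputable section

namespace NK2

/-! ### The polynomial operators on monomials -/

section Evaluation

variable {V : Type u} [AddCommGroup V] [Module ℂ V]
variable {W : Type v} [AddCommGroup W] [Module ℂ W]

@[simp] lemma sgn_one : sgn 1 = -1 := by simp [sgn]

@[simp] lemma bit_true : bit true = 1 := rfl

@[simp] lemma bit_false : bit false = 0 := rfl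

@[simp] lemma Mon.parity_mk (j : ℕ) (a b : Bool) : Mon.parity (j, a, b) = bit a + bit b := rfl

@[simp] lemma one_add_one_zmod_two : (1 + 1 : ZMod 2) = 0 := rfl

@[simp] lemma lam_single (j : ℕ) (m : Bool × Bool) (v : V) :
    lam (Finsupp.single (j, m) v) = Finsupp.single (j + 1, m) v := by
  simp [lam]

@[simp] lemma chi_zero_single (j : ℕ) (a b : Bool) (v : V) :
    chi 0 (Finsupp.single (j, a, b) v) =
      if a then -Finsupp.single (j + 1, false, b) v else Finsupp.single (j, true, b) v := by
  cases a <;> simp [chi]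

@[simp] lemma chi_one_single (j : ℕ) (a b : Bool) (v : V) :
    chi 1 (Finsupp.single (j, a, b) v) = sgn (bit a) •
      if b then -Finsupp.single (j + 1, a, false) v else Finsupp.single (j, a, true) v := by
  cases b <;> simp [chi]

@[simp] lemma dchi_zero_single (j : ℕ) (a b : Bool) (v : V) :
    dchi 0 (Finsupp.single (j, a, b) v) =
      if a then Finsupp.single (j, false, b) v else 0 := by
  cases a <;> simp [dchi]

@[simp] lemma dchi_one_single (j : ℕ) (a b : Bool) (v : V) :
    dchi 1 (Finsupp.single (j, a, b) v) =
      sgn (bit a) • if b then Finsupp.single (j, a, false) v else 0 := by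
  cases b <;> simp [dchi]

@[simp] lemma subst_single (e : V →ₗ[ℂ] W) (l : Module.End ℂ W) (x : Fin 2 → Module.End ℂ W)
    (j : ℕ) (a b : Bool) (v : V) :
    subst e l x (Finsupp.single (j, a, b) v) =
      (l ^ j) ((if a then x 0 else 1) ((if b then x 1 else 1) (e v))) := by
  cases a <;> cases b <;> simp [subst]

@[simp] lemma integral_single (e : V →ₗ[ℂ] W) (T : Module.End ℂ W)
    (j : ℕ) (a b : Bool) (v : V) :
    integral e T (Finsupp.single (j, a, b) v) =
      if a && b then (-((j : ℂ) + 1)⁻¹) • (T ^ (j + 1)) (e v) else 0 := by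
  cases a <;> cases b <;> simp [integral]

end Evaluation

/-! ### Brackets with the vacuum, and the relations between D¹ and D² -/

namespace SUSYVertexAlgebra

variable {W : Type u} [AddCommGroup W] [Module ℂ W] (𝒲 : SUSYVertexAlgebra W)

/-- Since D¹ kills the vacuum, sesquilinearity gives χ¹[|0⟩ _Λ v] = 0, and left multiplication by χ¹
is injective because (χ¹)² = -λ. -/
lemma vac_bracket (v : W) : 𝒲.bracket 𝒲.vac v = 0 := by
  apply chi_injective
  have := 𝒲.sesqui_left 0 𝒲.vac v
  rw [D_vac] at this
  simpa using this.symm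

lemma bracket_vac {p : ZMod 2} {v : W} (hv : v ∈ homog 𝒲.parity p) :
    𝒲.bracket v 𝒲.vac = 0 := by
  rw [𝒲.skew 0 p _ 𝒲.vac_even v hv, vac_bracket]
  simp

lemma D_one_D_one (v : W) : 𝒲.D 1 (𝒲.D 1 v) = 𝒲.D 0 (𝒲.D 0 v) :=
  (congrArg (fun T : Module.End ℂ W => T v) 𝒲.D_sq).symm

lemma D_one_D_zero (v : W) : 𝒲.D 1 (𝒲.D 0 v) = -𝒲.D 0 (𝒲.D 1 v) :=
  eq_neg_of_add_eq_zero_right (congrArg (fun T : Module.End ℂ W => T v) 𝒲.D_anticomm)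

end SUSYVertexAlgebra

/-! ### Chiral systems: brackets of the generators with P -/

/-- Even vectors `X a` and odd vectors `Y a` that form pairs with `[X_a _Λ Y_b] = δ_ab (- i χ¹ + χ²)`
and are killed by `i D¹ - D²`. -/
structure IsChiralSystem {A : Type v} [DecidableEq A] {W : Type u} [AddCommGroup W] [Module ℂ W]
    (𝒲 : SUSYVertexAlgebra W) (X Y : A → W) : Prop where
  even : ∀ a, X a ∈ homog 𝒲.parity 0
  odd : ∀ a, Y a ∈ homog 𝒲.parity 1
  bracket_even_odd : ∀ a b, 𝒲.bracket (X a) (Y b) =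
    if a = b then -(Complex.I • chi 0 (const 𝒲.vac)) + chi 1 (const 𝒲.vac) else 0
  bracket_even_even : ∀ a b, 𝒲.bracket (X a) (X b) = 0
  bracket_odd_odd : ∀ a b, 𝒲.bracket (Y a) (Y b) = 0
  D_even : ∀ a, 𝒲.D 1 (X a) = Complex.I • 𝒲.D 0 (X a)
  D_odd : ∀ a, 𝒲.D 1 (Y a) = Complex.I • 𝒲.D 0 (Y a)

/-- The vector `- i ∑ ((t_a + 1) (D¹X_a) Y_a + t_a X_a (D¹Y_a))`. -/
def chiralVector {A : Type v} [Fintype A] {W : Type u} [AddCommGroup W] [Module ℂ W]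
    (𝒲 : SUSYVertexAlgebra W) (X Y : A → W) (t : A → ℂ) : W :=
  -(Complex.I • ∑ a, ((t a + 1) • 𝒲.mul (𝒲.D 0 (X a)) (Y a) + t a • 𝒲.mul (X a) (𝒲.D 0 (Y a))))

namespace IsChiralSystem

variable {A : Type v} [DecidableEq A] {W : Type u} [AddCommGroup W] [Module ℂ W]
  {𝒲 : SUSYVertexAlgebra W} {X Y : A → W} (h : IsChiralSystem 𝒲 X Y)
include h

lemma D_zero_even_mem (a : A) : 𝒲.D 0 (X a) ∈ homog 𝒲.parity 1 := by
  simpa using 𝒲.D_odd 0 0 _ (h.even a)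

lemma D_zero_odd_mem (a : A) : 𝒲.D 0 (Y a) ∈ homog 𝒲.parity 0 := by
  simpa using 𝒲.D_odd 0 1 _ (h.odd a)

/-- The pairing is symmetric: it is linear in the χⁱ and the Dⁱ kill the vacuum, so Λ ↦ -∇-Λ changes
its sign, which cancels the minus sign of skew-symmetry. The Koszul sign is trivial because X is
even. -/
lemma bracket_odd_even (a b : A) : 𝒲.bracket (Y a) (X b) =
    if a = b then -(Complex.I • chi 0 (const 𝒲.vac)) + chi 1 (const 𝒲.vac) else 0 := by
  rw [𝒲.skew 0 1 _ (h.even b) _ (h.odd a), h.bracket_even_odd]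
  by_cases e : b = a
  · simp [e, const_apply, substNeg, actD, D_vac]
    abel
  · simp [e, Ne.symm e]

/-- On the vacuum D¹(-iχ¹ + χ²) = -2iλ, by D¹χ¹ = -χ¹D¹ + 2λ, while χ¹(-iχ¹ + χ²) = iλ + χ¹χ². -/
lemma bracket_even_D_odd (a b : A) : 𝒲.bracket (X a) (𝒲.D 0 (Y b)) =
    if a = b then Finsupp.single (0, true, true) 𝒲.vac -
      Complex.I • Finsupp.single (1, false, false) 𝒲.vac else 0 := by
  rw [𝒲.sesqui_right 0 0 _ (h.even a), h.bracket_even_odd]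
  split_ifs
  · simp [const_apply, actD, D_vac]
    simp only [← Finsupp.smul_single]
    module
  · simp

lemma bracket_even_D_even (a b : A) : 𝒲.bracket (X a) (𝒲.D 0 (X b)) = 0 := by
  rw [𝒲.sesqui_right 0 0 _ (h.even a), h.bracket_even_even]
  simp

lemma bracket_odd_D_odd (a b : A) : 𝒲.bracket (Y a) (𝒲.D 0 (Y b)) = 0 := by
  rw [𝒲.sesqui_right 0 1 _ (h.odd a), h.bracket_odd_odd]
  simp

lemma bracket_odd_D_even (a b : A) : 𝒲.bracket (Y a) (𝒲.D 0 (X b)) =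
    if a = b then -Finsupp.single (0, true, true) 𝒲.vac +
      Complex.I • Finsupp.single (1, false, false) 𝒲.vac else 0 := by
  rw [𝒲.sesqui_right 0 1 _ (h.odd a), h.bracket_odd_even]
  split_ifs
  · simp [const_apply, actD, D_vac]
    simp only [← Finsupp.smul_single]
    module
  · simp

/-- In the Wick formula X_a contracts only with Y_b or D¹Y_b, the right factor of each monomial. The
bracket with the left factor is zero, so the integral term is zero as well. -/
lemma even_bracket_chiralVector [Fintype A] (t : A → ℂ) (a : A) :
    𝒲.bracket (X a) (chiralVector 𝒲 X Y t) =
      Finsupp.single (0, true, false) ((t a + 1) • 𝒲.D 0 (X a)) +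
      Finsupp.single (0, false, true) ((Complex.I * (t a + 1)) • 𝒲.D 0 (X a)) -
      Finsupp.single (0, true, true) ((Complex.I * t a) • X a) -
      Finsupp.single (1, false, false) (t a • X a) := by
  have h1 : ∀ b, 𝒲.bracket (X a) (𝒲.mul (𝒲.D 0 (X b)) (Y b)) = if a = b then
      Complex.I • Finsupp.single (0, true, false) (𝒲.D 0 (X a)) -
        Finsupp.single (0, false, true) (𝒲.D 0 (X a)) else 0 := by
    intro b
    rw [𝒲.wick 0 1 _ (h.even a) _ (h.D_zero_even_mem b), h.bracket_even_D_even,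
      h.bracket_even_odd]
    split_ifs with e
    · subst e
      simp [const_apply, 𝒲.mul_vac]
      abel
    · simp
  have h2 : ∀ b, 𝒲.bracket (X a) (𝒲.mul (X b) (𝒲.D 0 (Y b))) = if a = b then
      Finsupp.single (0, true, true) (X a) -
        Complex.I • Finsupp.single (1, false, false) (X a) else 0 := by
    intro b
    rw [𝒲.wick 0 0 _ (h.even a) _ (h.even b), h.bracket_even_even, h.bracket_even_D_odd]
    split_ifs with e
    · subst e
      simp [𝒲.mul_vac]
    · simp
  simp only [chiralVector, map_neg, map_smul, map_sum, map_add, h1, h2, smul_ite, smul_zero,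
    Finset.sum_add_distrib, Finset.sum_ite_eq, Finset.mem_univ, if_true]
  simp only [← Finsupp.smul_single]
  match_scalars <;> ring_nf <;> simp only [Complex.I_sq] <;> ring

end IsChiralSystem

/-! ### Sesquilinearity for P, and brackets of P with generators and quadratic monomials -/

/-- The bracket `[P _Λ v] = (2∂ + χ¹D¹ + χ²D² + w(λ - iχ¹χ²)) v` of a vector `v` with
`D² v = i D¹ v`. -/
def chiralBracket {W : Type u} [AddCommGroup W] [Module ℂ W] (𝒲 : SUSYVertexAlgebra W)
    (w : ℂ) (v : W) : Lam W :=
  Finsupp.single (0, false, false) ((2 : ℂ) • 𝒲.D 0 (𝒲.D 0 v)) +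
    Finsupp.single (0, true, false) (𝒲.D 0 v) +
    Finsupp.single (0, false, true) (Complex.I • 𝒲.D 0 v) +
    Finsupp.single (1, false, false) (w • v) -
    Finsupp.single (0, true, true) ((Complex.I * w) • v)

/-- The result no longer has the shape of `chiralBracket`: the terms wλχ¹ - iwλχ² are new. They
arise when χ¹ multiplies w(λ - iχ¹χ²) and when D¹ moves past χ¹ in χ¹χ², and they are the source of
the anomalous multiples of X_aY_a below. -/
lemma bracket_D_of_chiralBracket {W : Type u} [AddCommGroup W] [Module ℂ W]
    (𝒲 : SUSYVertexAlgebra W) {P v : W} {w : ℂ} (hP : P ∈ homog 𝒲.parity 0)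
    (hv : 𝒲.bracket P v = chiralBracket 𝒲 w v) :
    𝒲.bracket P (𝒲.D 0 v) =
      Finsupp.single (0, false, false) ((2 : ℂ) • 𝒲.D 0 (𝒲.D 0 (𝒲.D 0 v))) +
      Finsupp.single (0, true, false) (𝒲.D 0 (𝒲.D 0 v)) -
      Finsupp.single (0, false, true) (Complex.I • 𝒲.D 0 (𝒲.D 0 v)) +
      Finsupp.single (1, false, false) ((1 + w) • 𝒲.D 0 v) +
      Finsupp.single (0, true, true) ((Complex.I * (1 - w)) • 𝒲.D 0 v) +
      Finsupp.single (1, true, false) (w • v) -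
      Finsupp.single (1, false, true) ((Complex.I * w) • v) := by
  rw [𝒲.sesqui_right 0 0 P hP, hv, chiralBracket]
  simp [actD]
  simp only [← Finsupp.smul_single]
  module

namespace IsChiralSystem

variable {A : Type v} [DecidableEq A] {W : Type u} [AddCommGroup W] [Module ℂ W]
  {𝒲 : SUSYVertexAlgebra W} {X Y : A → W} (h : IsChiralSystem 𝒲 X Y)
include h

/-- Here the contraction is with the left factor, X_b or D¹X_b, and is a multiple of the vacuum. The
integral term vanishes because the bracket of the vacuum with anything is zero. -/
lemma odd_bracket_chiralVector [Fintype A] (t : A → ℂ) (a : A) :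
    𝒲.bracket (Y a) (chiralVector 𝒲 X Y t) =
      Finsupp.single (0, true, true) ((Complex.I * (t a + 1)) • Y a) +
      Finsupp.single (1, false, false) ((t a + 1) • Y a) -
      Finsupp.single (0, true, false) (t a • 𝒲.D 0 (Y a)) -
      Finsupp.single (0, false, true) ((Complex.I * t a) • 𝒲.D 0 (Y a)) := by
  have h1 : ∀ b, 𝒲.bracket (Y a) (𝒲.mul (𝒲.D 0 (X b)) (Y b)) = if a = b then
      -Finsupp.single (0, true, true) (Y a) +
        Complex.I • Finsupp.single (1, false, false) (Y a) else 0 := by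
    intro b
    rw [𝒲.wick 1 1 _ (h.odd a) _ (h.D_zero_even_mem b), h.bracket_odd_D_even,
      h.bracket_odd_odd]
    split_ifs with e
    · subst e
      simp [𝒲.vac_mul, 𝒲.vac_bracket]
    · simp
  have h2 : ∀ b, 𝒲.bracket (Y a) (𝒲.mul (X b) (𝒲.D 0 (Y b))) = if a = b then
      -(Complex.I • Finsupp.single (0, true, false) (𝒲.D 0 (Y a))) +
        Finsupp.single (0, false, true) (𝒲.D 0 (Y a)) else 0 := by
    intro b
    rw [𝒲.wick 1 0 _ (h.odd a) _ (h.even b), h.bracket_odd_even, h.bracket_odd_D_odd]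
    split_ifs with e
    · subst e
      simp [const_apply, 𝒲.vac_mul, 𝒲.vac_bracket]
    · simp
  simp only [chiralVector, map_neg, map_smul, map_sum, map_add, h1, h2, smul_ite, smul_zero,
    Finset.sum_add_distrib, Finset.sum_ite_eq, Finset.mem_univ, if_true]
  simp only [← Finsupp.smul_single]
  match_scalars <;> ring_nf <;> simp only [Complex.I_sq] <;> ring

lemma chiralVector_mem [Fintype A] (t : A → ℂ) :
    chiralVector 𝒲 X Y t ∈ homog 𝒲.parity 0 := by
  refine neg_mem (Submodule.smul_mem _ _ (sum_mem fun a _ => add_mem ?_ ?_)) <;>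
    refine Submodule.smul_mem _ _ ?_
  · simpa using 𝒲.mul_parity 1 1 _ (h.D_zero_even_mem a) _ (h.odd a)
  · simpa using 𝒲.mul_parity 0 0 _ (h.even a) _ (h.D_zero_odd_mem a)

/-- After the substitution Λ ↦ -∇-Λ, the relation D²X_a = iD¹X_a collects all derivatives into ∂X_a
and D¹X_a. Then `t a` cancels from the coefficients of 1, χ¹, χ² and survives only as the weight. -/
lemma chiralVector_bracket_even [Fintype A] (t : A → ℂ) (a : A) :
    𝒲.bracket (chiralVector 𝒲 X Y t) (X a) = chiralBracket 𝒲 (-t a) (X a) := by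
  rw [𝒲.skew 0 0 _ (h.even a) _ (h.chiralVector_mem t), h.even_bracket_chiralVector]
  simp [substNeg, const_apply, actD, 𝒲.D_one_D_zero, h.D_even, chiralBracket]
  simp only [← Finsupp.smul_single]
  match_scalars <;> ring_nf <;> simp only [Complex.I_sq] <;> ring

lemma chiralVector_bracket_odd [Fintype A] (t : A → ℂ) (a : A) :
    𝒲.bracket (chiralVector 𝒲 X Y t) (Y a) = chiralBracket 𝒲 (t a + 1) (Y a) := by
  rw [𝒲.skew 1 0 _ (h.odd a) _ (h.chiralVector_mem t), h.odd_bracket_chiralVector]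
  simp [substNeg, const_apply, actD, 𝒲.D_one_D_zero, h.D_odd, chiralBracket]
  simp only [← Finsupp.smul_single]
  match_scalars <;> ring_nf <;> simp only [Complex.I_sq] <;> ring

/-- The multiples of X_aY_a come from [P _Λ D¹X_a]Y_a. The vacuum terms are the double contraction
in the Wick integral, where [D¹X_a _Γ Y_a] = (-iγ - η¹η²)|0⟩. -/
lemma chiralVector_bracket_D_even_mul_odd [Fintype A] (t : A → ℂ) (a : A) :
    𝒲.bracket (chiralVector 𝒲 X Y t) (𝒲.mul (𝒲.D 0 (X a)) (Y a)) =
      Finsupp.single (0, false, false) ((2 : ℂ) • 𝒲.D 0 (𝒲.D 0 (𝒲.mul (𝒲.D 0 (X a)) (Y a)))) +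
      Finsupp.single (0, true, false) (𝒲.D 0 (𝒲.mul (𝒲.D 0 (X a)) (Y a))) +
      Finsupp.single (0, false, true) (𝒲.D 1 (𝒲.mul (𝒲.D 0 (X a)) (Y a))) +
      Finsupp.single (1, false, false) ((2 : ℂ) • 𝒲.mul (𝒲.D 0 (X a)) (Y a)) -
      Finsupp.single (1, true, false) (t a • 𝒲.mul (X a) (Y a)) +
      Finsupp.single (1, false, true) ((Complex.I * t a) • 𝒲.mul (X a) (Y a)) -
      Finsupp.single (2, false, false) (t a • 𝒲.vac) +
      Finsupp.single (1, true, true) ((Complex.I * (1 + t a)) • 𝒲.vac) := by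
  -- ∂ applied to (D¹X_a)Y_a is D¹ applied twice, so the Leibniz rule also needs the parity of the
  -- left factor ∂X_a.
  have hXX : 𝒲.D 0 (𝒲.D 0 (X a)) ∈ homog 𝒲.parity 0 := by
    simpa using 𝒲.D_odd 0 1 _ (h.D_zero_even_mem a)
  rw [𝒲.wick 0 1 _ (h.chiralVector_mem t) _ (h.D_zero_even_mem a), h.chiralVector_bracket_odd,
    bracket_D_of_chiralBracket 𝒲 (h.chiralVector_mem t) (h.chiralVector_bracket_even t a),
    chiralBracket]
  simp [pow_two, 𝒲.D_mul _ _ _ (h.D_zero_even_mem a), 𝒲.D_mul _ _ _ hXX, 𝒲.D_one_D_zero, h.D_even,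
    h.D_odd, 𝒲.sesqui_left, h.bracket_even_odd, const_apply]
  simp only [← Finsupp.smul_single]
  match_scalars <;> ring_nf

/-- Now the multiples of X_aY_a come from X_a[P _Λ D¹Y_a], and the double contraction uses [X_a _Γ
D¹Y_a] = (η¹η² - iγ)|0⟩. -/
lemma chiralVector_bracket_even_mul_D_odd [Fintype A] (t : A → ℂ) (a : A) :
    𝒲.bracket (chiralVector 𝒲 X Y t) (𝒲.mul (X a) (𝒲.D 0 (Y a))) =
      Finsupp.single (0, false, false) ((2 : ℂ) • 𝒲.D 0 (𝒲.D 0 (𝒲.mul (X a) (𝒲.D 0 (Y a))))) +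
      Finsupp.single (0, true, false) (𝒲.D 0 (𝒲.mul (X a) (𝒲.D 0 (Y a)))) +
      Finsupp.single (0, false, true) (𝒲.D 1 (𝒲.mul (X a) (𝒲.D 0 (Y a)))) +
      Finsupp.single (1, false, false) ((2 : ℂ) • 𝒲.mul (X a) (𝒲.D 0 (Y a))) +
      Finsupp.single (1, true, false) ((t a + 1) • 𝒲.mul (X a) (Y a)) -
      Finsupp.single (1, false, true) ((Complex.I * (t a + 1)) • 𝒲.mul (X a) (Y a)) +
      Finsupp.single (2, false, false) ((t a + 1) • 𝒲.vac) -
      Finsupp.single (1, true, true) ((Complex.I * t a) • 𝒲.vac) := by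
  rw [𝒲.wick 0 0 _ (h.chiralVector_mem t) _ (h.even a), h.chiralVector_bracket_even,
    bracket_D_of_chiralBracket 𝒲 (h.chiralVector_mem t) (h.chiralVector_bracket_odd t a),
    chiralBracket]
  simp [pow_two, 𝒲.D_mul _ _ _ (h.D_zero_even_mem a), 𝒲.D_mul _ _ _ (h.even a), 𝒲.D_one_D_zero, h.D_even,
    h.D_odd, 𝒲.sesqui_left, h.bracket_even_D_odd, const_apply]
  simp only [← Finsupp.smul_single]
  match_scalars <;> ring_nf

end IsChiralSystem

/-! ### The bracket of P with itself and the central charge -/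

lemma IsChiralSystem.chiralVector_bracket_self {A : Type v} [DecidableEq A] [Fintype A]
    {W : Type u} [AddCommGroup W] [Module ℂ W] {𝒲 : SUSYVertexAlgebra W} {X Y : A → W}
    (h : IsChiralSystem 𝒲 X Y) (t : A → ℂ) :
    𝒲.bracket (chiralVector 𝒲 X Y t) (chiralVector 𝒲 X Y t) =
      const ((2 : ℂ) • 𝒲.del (chiralVector 𝒲 X Y t)) + lam (const ((2 : ℂ) • chiralVector 𝒲 X Y t)) +
      chi 0 (const (𝒲.D 0 (chiralVector 𝒲 X Y t))) + chi 1 (const (𝒲.D 1 (chiralVector 𝒲 X Y t))) +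
      lam (chi 0 (chi 1 (const (((∑ a, (6 * t a + 3)) / 3) • 𝒲.vac)))) := by
  -- The non-central part of the bracket depends linearly on the vector; as a linear map it
  -- distributes over the sum that defines P.
  obtain ⟨E, hE⟩ : ∃ E : W →ₗ[ℂ] Lam W, ∀ v, E v = const ((2 : ℂ) • 𝒲.del v) +
      lam (const ((2 : ℂ) • v)) + chi 0 (const (𝒲.D 0 v)) + chi 1 (const (𝒲.D 1 v)) :=
    ⟨const ∘ₗ ((2 : ℂ) • 𝒲.del : Module.End ℂ W) + (2 : ℂ) • (lam ∘ₗ const) +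
      chi 0 ∘ₗ const ∘ₗ 𝒲.D 0 + chi 1 ∘ₗ const ∘ₗ 𝒲.D 1, fun v => by simp⟩
  -- The terms in λχ¹, λχ² and λ² cancel since (t_a+1)t_a = t_a(t_a+1); that in λχ¹χ² is i((t_a+1)²
  -- - t_a²) = i(2t_a+1).
  have key : ∀ a, 𝒲.bracket (chiralVector 𝒲 X Y t)
      ((t a + 1) • 𝒲.mul (𝒲.D 0 (X a)) (Y a) + t a • 𝒲.mul (X a) (𝒲.D 0 (Y a))) =
      E ((t a + 1) • 𝒲.mul (𝒲.D 0 (X a)) (Y a) + t a • 𝒲.mul (X a) (𝒲.D 0 (Y a))) +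
      (Complex.I * (2 * t a + 1)) • lam (chi 0 (chi 1 (const 𝒲.vac))) := by
    intro a
    rw [map_add, map_smul, map_smul, h.chiralVector_bracket_D_even_mul_odd,
      h.chiralVector_bracket_even_mul_D_odd, map_add, map_smul, map_smul, hE, hE]
    simp only [const_apply, lam_single, chi_zero_single, chi_one_single, bit_false, sgn_zero,
      SUSYLieConformalAlgebra.del, Module.End.mul_apply, if_false, Bool.false_eq_true,
      zero_add, one_smul]
    simp only [← Finsupp.smul_single]
    module
  have hsum : (∑ a, (6 * t a + 3)) / 3 = ∑ a, (2 * t a + 1) := by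
    rw [Finset.sum_div]
    exact Finset.sum_congr rfl fun a _ => by ring
  rw [← hE, hsum, map_smul, map_smul, map_smul, map_smul]
  -- Only the second argument of the bracket is expanded; the first stays P, as in `key`.
  have e1 := congrArg (𝒲.bracket (chiralVector 𝒲 X Y t)) (chiralVector.eq_1 𝒲 X Y t)
  have e2 := congrArg E (chiralVector.eq_1 𝒲 X Y t)
  rw [map_neg, map_smul, map_sum] at e1 e2
  rw [e1, e2, Finset.sum_congr rfl fun a _ => key a, Finset.sum_add_distrib, ← Finset.sum_smul,
    ← Finset.mul_sum, smul_add, neg_add, smul_smul, ← mul_assoc, Complex.I_mul_I, ← neg_smul _ (lam _)]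
  congr 2
  ring

/-! ### Coefficients of low order in λ -/

section Coefficients

variable {V : Type u} [AddCommGroup V] [Module ℂ V]
variable {W : Type v} [AddCommGroup W] [Module ℂ W]

lemma coefMap_apply (q : ZMod 2) (T : V →ₗ[ℂ] W) (x : Lam V) (m : Mon) :
    coefMap q T x m = sgn (q * m.parity) • T (x m) := by
  induction x using Finsupp.induction_linear with
  | zero => simp
  | add x y hx hy => simp [hx, hy]
  | single n v =>
    by_cases h : n = m
    · subst h; simp
    · simp [Finsupp.single_eq_of_ne' h]

lemma lam_apply_zero (x : Lam V) (m : Bool × Bool) : lam x (0, m) = 0 := by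
  induction x using Finsupp.induction_linear with
  | zero => simp
  | add x y hx hy => simp [hx, hy]
  | single n v => simp [lam]

lemma lam_apply_succ (x : Lam V) (j : ℕ) (m : Bool × Bool) : lam x (j + 1, m) = x (j, m) := by
  induction x using Finsupp.induction_linear with
  | zero => simp
  | add x y hx hy => simp [hx, hy]
  | single n v => obtain ⟨k, n⟩ := n; simp [Finsupp.single_apply]

lemma chi_zero_apply_zero (x : Lam V) (b : Bool) : chi 0 x (0, false, b) = 0 := by
  induction x using Finsupp.induction_linear with
  | zero => simp
  | add x y hx hy => simp [hx, hy]
  | single n v => obtain ⟨k, a, b'⟩ := n; cases a <;> simp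

lemma chi_zero_apply_succ (x : Lam V) (j : ℕ) (b : Bool) :
    chi 0 x (j + 1, false, b) = -x (j, true, b) := by
  induction x using Finsupp.induction_linear with
  | zero => simp
  | add x y hx hy => simp [hx, hy, add_comm]
  | single n v => obtain ⟨k, a, b'⟩ := n; cases a <;> simp [Finsupp.single_apply]

lemma chi_zero_apply_true (x : Lam V) (j : ℕ) (b : Bool) :
    chi 0 x (j, true, b) = x (j, false, b) := by
  induction x using Finsupp.induction_linear with
  | zero => simp
  | add x y hx hy => simp [hx, hy]
  | single n v => obtain ⟨k, a, b'⟩ := n; cases a <;> simp [Finsupp.single_apply]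

lemma chi_one_apply_zero (x : Lam V) (a : Bool) : chi 1 x (0, a, false) = 0 := by
  induction x using Finsupp.induction_linear with
  | zero => simp
  | add x y hx hy => simp [hx, hy]
  | single n v =>
    obtain ⟨k, a', b'⟩ := n
    cases a <;> cases a' <;> cases b' <;> simp

lemma chi_one_apply_succ (x : Lam V) (j : ℕ) (a : Bool) :
    chi 1 x (j + 1, a, false) = -(sgn (bit a) • x (j, a, true)) := by
  induction x using Finsupp.induction_linear with
  | zero => simp
  | add x y hx hy => simp [hx, hy, add_comm]
  | single n v =>
    obtain ⟨k, a', b'⟩ := n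
    cases a <;> cases a' <;> cases b' <;> simp [Finsupp.single_apply]
    split_ifs <;> simp

lemma chi_one_apply_true (x : Lam V) (j : ℕ) (a : Bool) :
    chi 1 x (j, a, true) = sgn (bit a) • x (j, a, false) := by
  induction x using Finsupp.induction_linear with
  | zero => simp
  | add x y hx hy => simp [hx, hy]
  | single n v =>
    obtain ⟨k, a', b'⟩ := n
    cases a <;> cases a' <;> cases b' <;> simp [Finsupp.single_apply]
    split_ifs <;> simp

lemma dchi_zero_apply (x : Lam V) (j : ℕ) (b : Bool) :
    dchi 0 x (j, false, b) = x (j, true, b) := by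
  induction x using Finsupp.induction_linear with
  | zero => simp
  | add x y hx hy => simp [hx, hy]
  | single n v => obtain ⟨k, a, b'⟩ := n; cases a <;> simp [Finsupp.single_apply]

lemma dchi_one_apply (x : Lam V) (j : ℕ) (a : Bool) :
    dchi 1 x (j, a, false) = sgn (bit a) • x (j, a, true) := by
  induction x using Finsupp.induction_linear with
  | zero => simp
  | add x y hx hy => simp [hx, hy]
  | single n v =>
    obtain ⟨k, a', b'⟩ := n
    cases a <;> cases a' <;> cases b' <;> simp [Finsupp.single_apply]
    split_ifs <;> simp

lemma integral_const_lam_single (j : ℕ) (a b : Bool) (v : V) :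
    integral const lam (Finsupp.single (j, a, b) v) =
      if a && b then (-((j : ℂ) + 1)⁻¹) • Finsupp.single (j + 1, false, false) v else 0 := by
  have hpow : ∀ n : ℕ, (lam ^ n) (const v) = Finsupp.single (n, false, false) v := by
    intro n
    induction n with
    | zero => rfl
    | succ n ih => rw [pow_succ', Module.End.mul_apply, ih, lam_single]
  rw [integral_single, hpow]

lemma integral_const_lam_apply_zero (x : Lam V) (m : Bool × Bool) :
    integral const lam x (0, m) = 0 := by
  induction x using Finsupp.induction_linear with
  | zero => simp
  | add x y hx hy => simp [hx, hy]
  | single n v =>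
    obtain ⟨k, a, b⟩ := n
    rw [integral_const_lam_single]
    cases a <;> cases b <;> simp

lemma integral_const_lam_apply_one (x : Lam V) :
    integral const lam x (1, false, false) = -x (0, true, true) := by
  induction x using Finsupp.induction_linear with
  | zero => simp
  | add x y hx hy => simp [hx, hy, add_comm]
  | single n v =>
    obtain ⟨k, a, b⟩ := n
    rw [integral_const_lam_single]
    cases a <;> cases b <;> simp [Finsupp.single_apply]
    split_ifs with hk
    · simp [hk]
    · simp

/-- Multiplication by λ or χⁱ never lowers the λ-degree. This applies to the integral term of the
Wick formula, which starts in λ-degree 1. -/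
lemma subst_lam_chi_apply_zero (e : V →ₗ[ℂ] Lam W) (he : ∀ v m, e v (0, m) = 0) (x : Lam V)
    (m : Bool × Bool) : subst e lam chi x (0, m) = 0 := by
  induction x using Finsupp.induction_linear with
  | zero => simp
  | add x y hx hy => simp [hx, hy]
  | single n v =>
    obtain ⟨k, a, b⟩ := n
    obtain ⟨c, d⟩ := m
    rw [subst_single]
    cases k with
    | succ k => rw [pow_succ', Module.End.mul_apply, lam_apply_zero]
    | zero =>
      cases a <;> cases b <;> cases c <;> cases d <;>
        simp [he, chi_zero_apply_zero, chi_zero_apply_true, chi_one_apply_zero, chi_one_apply_true]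

/-- A factor λ raises a polynomial without λ⁰ part to λ-degree at least 2. A factor χⁱ reaches the
monomial λ only through (χⁱ)² = -λ acting on the λ⁰ part, which is zero. -/
lemma subst_lam_chi_apply_one (e : V →ₗ[ℂ] Lam W) (he : ∀ v m, e v (0, m) = 0) (x : Lam V) :
    subst e lam chi x (1, false, false) = e (x (0, false, false)) (1, false, false) := by
  induction x using Finsupp.induction_linear with
  | zero => simp
  | add x y hx hy => simp [hx, hy]
  | single n v =>
    obtain ⟨k, a, b⟩ := n
    have h0 := subst_lam_chi_apply_zero e he (Finsupp.single (0, a, b) v)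
    -- The successor rules at `j = 0`, to be restated with `1` in place of `0 + 1` so that they
    -- match the goal.
    have h1 := fun x => lam_apply_succ (V := W) x 0
    have h2 := fun x => chi_zero_apply_succ (V := W) x 0
    have h3 := fun x => chi_one_apply_succ (V := W) x 0
    simp only [zero_add] at h1 h2 h3
    rw [subst_single] at h0 ⊢
    match k with
    | k + 2 =>
      rw [pow_succ', Module.End.mul_apply, h1, pow_succ', Module.End.mul_apply, lam_apply_zero]
      simp
    | 1 =>
      rw [pow_one, h1]
      simpa using h0 (false, false)
    | 0 =>
      cases a <;> cases b <;> simp [he, h2, h3, chi_one_apply_zero]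

end Coefficients

/-! ### Weight vectors of P -/

/-- The coefficients of `1`, `χ¹` and `χ²` in `[P _Λ v]` are `2∂v`, `D¹v` and `D²v`, and `v` is an
eigenvector, if nonzero, of the coefficient of `λ`. -/
structure IsWeightVector {W : Type u} [AddCommGroup W] [Module ℂ W] (𝒲 : SUSYVertexAlgebra W)
    (P v : W) (w : ℂ) : Prop where
  coeff_one : 𝒲.bracket P v (0, false, false) = (2 : ℂ) • 𝒲.D 0 (𝒲.D 0 v)
  coeff_chi_one : 𝒲.bracket P v (0, true, false) = 𝒲.D 0 v
  coeff_chi_two : 𝒲.bracket P v (0, false, true) = 𝒲.D 1 v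
  coeff_lam : 𝒲.bracket P v (1, false, false) = w • v

namespace IsWeightVector

variable {W : Type u} [AddCommGroup W] [Module ℂ W] {𝒲 : SUSYVertexAlgebra W} {P : W}

lemma vac (hP : P ∈ homog 𝒲.parity 0) : IsWeightVector 𝒲 P 𝒲.vac 0 := by
  have h := 𝒲.bracket_vac hP
  constructor <;> simp [h, D_vac]

lemma of_chiralBracket {v : W} {w : ℂ} (h : 𝒲.bracket P v = chiralBracket 𝒲 w v)
    (hD : 𝒲.D 1 v = Complex.I • 𝒲.D 0 v) : IsWeightVector 𝒲 P v w := by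
  constructor <;> simp [h, chiralBracket, hD]

/-- By sesquilinearity these four coefficients of [P _Λ Dⁱv] depend only on the same four of [P _Λ
v]. In the coefficient of λ, Dⁱ contributes wDⁱv + 2Dⁱv and χⁱχⁱ = -λ contributes -Dⁱv, hence w + 1.
-/
lemma D (hP : P ∈ homog 𝒲.parity 0) {v : W} {w : ℂ} (h : IsWeightVector 𝒲 P v w) (i : Fin 2) :
    IsWeightVector 𝒲 P (𝒲.D i v) (w + 1) := by
  have hb := 𝒲.sesqui_right i 0 P hP v
  have h1 := fun x => lam_apply_succ (V := W) x 0
  have h2 := fun x => chi_zero_apply_succ (V := W) x 0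
  have h3 := fun x => chi_one_apply_succ (V := W) x 0
  simp only [zero_add] at h1 h2 h3
  obtain ⟨c0, c1, c2, cl⟩ := h
  rcases (by decide : ∀ i : Fin 2, i = 0 ∨ i = 1) i with rfl | rfl <;> constructor <;>
    simp [hb, actD, coefMap_apply, lam_apply_zero, h1, h2, h3, chi_zero_apply_zero,
      chi_zero_apply_true, chi_one_apply_zero, chi_one_apply_true, dchi_zero_apply,
      dchi_one_apply, c0, c1, c2, cl, 𝒲.D_one_D_one, 𝒲.D_one_D_zero] <;>
    module

/-- The Wick integral does not affect the coefficients of 1, χ¹, χ², which therefore obey the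
Leibniz rule. Its coefficient of λ sees only the constant term 2∂b of [P _Λ b], and that
contribution vanishes. -/
lemma mul (hP : P ∈ homog 𝒲.parity 0) {q : ZMod 2} {b c : W} {w w' : ℂ}
    (hb : b ∈ homog 𝒲.parity q) (h : IsWeightVector 𝒲 P b w) (h' : IsWeightVector 𝒲 P c w') :
    IsWeightVector 𝒲 P (𝒲.mul b c) (w + w') := by
  have he : ∀ v m, (integral const lam ∘ₗ 𝒲.bracket.flip c) v (0, m) = 0 := fun v m =>
    integral_const_lam_apply_zero _ m
  have hDb := 𝒲.D_odd 0 q b hb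
  -- [∂b _Γ c] = -γ[b _Γ c] has no term of degree zero in γ.
  have hDDb : 𝒲.bracket (𝒲.D 0 (𝒲.D 0 b)) c (0, true, true) = 0 := by
    rw [𝒲.sesqui_left, 𝒲.sesqui_left]
    simp [chi_zero_apply_true, chi_zero_apply_zero]
  have hs : ∀ r : ZMod 2, sgn (r + 1) = -sgn r := by
    intro r
    rcases (by decide : ∀ r : ZMod 2, r = 0 ∨ r = 1) r with rfl | rfl <;> simp
  constructor <;>
    simp [𝒲.wick 0 q P hP b hb, coefMap_apply, subst_lam_chi_apply_zero _ he,
      subst_lam_chi_apply_one _ he, integral_const_lam_apply_one, h.coeff_one, h.coeff_chi_one,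
      h.coeff_chi_two, h.coeff_lam, h'.coeff_one, h'.coeff_chi_one, h'.coeff_chi_two,
      h'.coeff_lam, hDDb, 𝒲.D_mul _ _ _ hb, 𝒲.D_mul _ _ _ hDb, hs, smul_smul, sgn_mul_self]
  module

end IsWeightVector

/-! ### Homomorphisms and words -/

section Words

variable {A : Type v} {V : Type u} [AddCommGroup V] [Module ℂ V]

lemma IsHom.eval {W : Type*} [AddCommGroup W] [Module ℂ W] {𝒱 : SUSYVertexAlgebra V}
    {𝒲 : SUSYVertexAlgebra W} {f : V →ₗ[ℂ] W} (hf : IsHom 𝒱 𝒲 f) (x y : A → V) (w : Word A) :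
    f (w.eval 𝒱 x y) = w.eval 𝒲 (fun a => f (x a)) fun a => f (y a) := by
  induction w with
  | vac => exact hf.vac
  | phi a => rfl
  | psi a => rfl
  | D i w ih => simp only [Word.eval, hf.D, ih]
  | mul w w' ih ih' => simp only [Word.eval, hf.mul, ih, ih']

lemma IsHom.comp {W X : Type*} [AddCommGroup W] [Module ℂ W] [AddCommGroup X] [Module ℂ X]
    {𝒱 : SUSYVertexAlgebra V} {𝒲 : SUSYVertexAlgebra W} {𝒳 : SUSYVertexAlgebra X}
    {f : V →ₗ[ℂ] W} {g : W →ₗ[ℂ] X} (hg : IsHom 𝒲 𝒳 g) (hf : IsHom 𝒱 𝒲 f) :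
    IsHom 𝒱 𝒳 (g ∘ₗ f) where
  parity a := by simp [hf.parity, hg.parity]
  D i a := by simp [hf.D, hg.D]
  vac := by simp [hf.vac, hg.vac]
  mul a b := by simp [hf.mul, hg.mul]
  bracket a b := by rw [coefMap_comp_apply, hf.bracket, hg.bracket]; rfl

lemma isHom_id (𝒱 : SUSYVertexAlgebra V) : IsHom 𝒱 𝒱 LinearMap.id where
  parity _ := rfl
  D _ _ := rfl
  vac := rfl
  mul _ _ := rfl
  bracket a b := by ext m; simp [coefMap_zero_apply]

lemma isHom_mkQ (𝒱 : SUSYVertexAlgebra V) (I : Submodule ℂ V) (hI : IsIdeal 𝒱 I) :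
    IsHom 𝒱 (𝒱.quotient I hI) I.mkQ where
  parity _ := rfl
  D _ _ := rfl
  vac := rfl
  mul _ _ := rfl
  bracket _ _ := rfl

lemma IsRealization.map [DecidableEq A] {par : A → ZMod 2} {W : Type*} [AddCommGroup W]
    [Module ℂ W] {𝒱 : SUSYVertexAlgebra V} {𝒲 : SUSYVertexAlgebra W} {x y : A → V}
    (h : IsRealization par 𝒱 x y) {f : V →ₗ[ℂ] W} (hf : IsHom 𝒱 𝒲 f) :
    IsRealization par 𝒲 (fun a => f (x a)) fun a => f (y a) where
  mem_left a := by rw [mem_homog, ← hf.parity, mem_homog.mp (h.mem_left a), map_smul]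
  mem_right a := by rw [mem_homog, ← hf.parity, mem_homog.mp (h.mem_right a), map_smul]
  bracket_left_right a b := by
    rw [← hf.bracket, h.bracket_left_right]
    split_ifs
    · simp only [map_add, map_neg, map_smul, chi_nat, const_nat, hf.vac]
    · exact map_zero _
  bracket_left_left a b := by rw [← hf.bracket, h.bracket_left_left, map_zero]
  bracket_right_right a b := by rw [← hf.bracket, h.bracket_right_right, map_zero]

end Words

/-- A universal envelope is spanned by the values of words. -/
lemma IsUniversalEnvelope.span_eval {A : Type u} [DecidableEq A] {par : A → ZMod 2}
    {V : Type u} [AddCommGroup V] [Module ℂ V] {𝒱 : SUSYVertexAlgebra V} {Φ Ψ : A → V}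
    (h : IsUniversalEnvelope par 𝒱 Φ Ψ) :
    Submodule.span ℂ (Set.range fun w : Word A => w.eval 𝒱 Φ Ψ) = ⊤ := by
  obtain ⟨f, ⟨hf, hfx, hfy⟩, -⟩ := h.universal (Envelope par) (envelope par) _ _
    (isRealization_envelope par)
  let M : Model par := ⟨V, 𝒱, Φ, Ψ, h.realization⟩
  -- Both maps are endomorphisms of the envelope fixing the generators, so uniqueness identifies
  -- them. Evaluation of words is therefore surjective.
  have hid : evEnvelope M ∘ₗ f = LinearMap.id := by
    refine (h.universal V 𝒱 Φ Ψ h.realization).unique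
      ⟨(isHom_evEnvelope M).comp hf, fun a => ?_, fun a => ?_⟩
      ⟨isHom_id 𝒱, fun _ => rfl, fun _ => rfl⟩
    · rw [LinearMap.comp_apply, hfx]
      exact evEnvelope_wordClass M _
    · rw [LinearMap.comp_apply, hfy]
      exact evEnvelope_wordClass M _
  rw [eq_top_iff]
  intro v _
  obtain ⟨x, hx⟩ := (vanishing par).mkQ_surjective (f v)
  have hv : v = M.ev _ x := by
    rw [← evEnvelope_mk, hx]
    exact (LinearMap.congr_fun hid v).symm
  rw [hv]
  clear hv hx
  induction x using Finsupp.induction_linear with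
  | zero => simp
  | add x y hx' hy' =>
    rw [map_add]
    exact add_mem hx' hy'
  | single w z =>
    rw [Model.ev_single]
    exact Submodule.smul_mem _ _ (Submodule.subset_span ⟨w.1, rfl⟩)

/-- The vectors `Φ_a`, `Φ^ā` of even and of odd parity form a chiral system. -/
lemma IsRealization.isChiralSystem {A : Type v} [DecidableEq A] {par : A → ZMod 2} {W : Type u}
    [AddCommGroup W] [Module ℂ W] {𝒲 : SUSYVertexAlgebra W} {x y : A → W}
    (h : IsRealization par 𝒲 x y) (hx : ∀ a, 𝒲.D 1 (x a) = Complex.I • 𝒲.D 0 (x a))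
    (hy : ∀ a, 𝒲.D 1 (y a) = Complex.I • 𝒲.D 0 (y a)) :
    IsChiralSystem 𝒲 (fun a => if par a = 0 then x a else y a)
      fun a => if par a = 0 then y a else x a := by
  have hpar : ∀ a, par a ≠ 0 → par a = 1 := fun a ha =>
    (by decide : ∀ p : ZMod 2, p ≠ 0 → p = 1) _ ha
  have hyx : ∀ a b, par a ≠ 0 → par b ≠ 0 → 𝒲.bracket (y a) (x b) =
      if a = b then -(Complex.I • chi 0 (const 𝒲.vac)) + chi 1 (const 𝒲.vac) else 0 := by
    intro a b ha hb
    rw [𝒲.skew _ _ _ (h.mem_left b) _ (h.mem_right a), h.bracket_left_right, hpar a ha, hpar b hb]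
    by_cases e : b = a
    · simp [e, const_apply, substNeg, actD, D_vac]
      abel
    · simp [e, Ne.symm e]
  have hyx0 : ∀ a b, a ≠ b → 𝒲.bracket (y a) (x b) = 0 := by
    intro a b hab
    rw [𝒲.skew _ _ _ (h.mem_left b) _ (h.mem_right a), h.bracket_left_right, if_neg hab.symm]
    simp
  constructor
  · intro a
    split_ifs with ha
    · exact ha ▸ h.mem_left a
    · simpa [hpar a ha] using h.mem_right a
  · intro a
    split_ifs with ha
    · simpa [ha] using h.mem_right a
    · exact hpar a ha ▸ h.mem_left a
  · intro a b
    split_ifs with ha hb hab hab hb hab hab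
    -- If `a` and `b` have different parities, both vectors are Φ's or both are Ψ's: the bracket is
    -- zero, and `a = b` is impossible.
    all_goals first
      | simpa [hab] using h.bracket_left_right a b
      | exact (h.bracket_left_left a b)
      | exact (h.bracket_right_right a b)
      | simpa [hab] using hyx a b ha hb
      | (subst hab; contradiction)
  · intro a b
    split_ifs with ha hb hb
    · exact h.bracket_left_left a b
    · rw [h.bracket_left_right, if_neg]
      rintro rfl
      exact hb ha
    · exact hyx0 a b fun e => ha (e ▸ hb)
    · exact h.bracket_right_right a b
  · intro a b
    split_ifs with ha hb hb
    · exact h.bracket_right_right a b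
    · exact hyx0 a b fun e => hb (e ▸ ha)
    · rw [h.bracket_left_right, if_neg]
      rintro rfl
      exact ha hb
    · exact h.bracket_left_left a b
  · intro a
    split_ifs
    exacts [hx a, hy a]
  · intro a
    split_ifs
    exacts [hy a, hx a]

lemma shiftedVector_eq_chiralVector {A : Type u} [Fintype A] (par : A → ZMod 2) {W : Type v}
    [AddCommGroup W] [Module ℂ W] (𝒲 : SUSYVertexAlgebra W) (x y : A → W) (t : A → ℂ) :
    shiftedVector par 𝒲 x y t = chiralVector 𝒲 (fun a => if par a = 0 then x a else y a)
      (fun a => if par a = 0 then y a else x a) t := by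
  have hpar : ∀ a, par a = 1 ↔ ¬par a = 0 := fun a =>
    (by decide : ∀ p : ZMod 2, p = 1 ↔ ¬p = 0) _
  rw [shiftedVector, chiralVector]
  congr 2
  rw [← Finset.sum_filter_add_sum_filter_not Finset.univ fun a => par a = 0]
  congr 1
  · refine Finset.sum_congr rfl fun a ha => ?_
    simp only [(Finset.mem_filter.mp ha).2, if_true]
  · simp only [hpar]
    refine Finset.sum_congr rfl fun a ha => ?_
    simp only [(Finset.mem_filter.mp ha).2, if_false]

/-- In a SUSY vertex algebra that is spanned by words in a realization that satisfies the relations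
`i D¹ = D²`, the shifted vector is superconformal. -/
lemma IsRealization.isSuperconformalVector {A : Type v} [Fintype A] [DecidableEq A]
    {par : A → ZMod 2} {W : Type u} [AddCommGroup W] [Module ℂ W] {𝒲 : SUSYVertexAlgebra W}
    {x y : A → W} (h : IsRealization par 𝒲 x y)
    (hx : ∀ a, 𝒲.D 1 (x a) = Complex.I • 𝒲.D 0 (x a))
    (hy : ∀ a, 𝒲.D 1 (y a) = Complex.I • 𝒲.D 0 (y a))
    (hspan : Submodule.span ℂ (Set.range fun w : Word A => w.eval 𝒲 x y) = ⊤) (t : A → ℂ) :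
    IsSuperconformalVector 𝒲 (shiftedVector par 𝒲 x y t) (∑ a, (6 * t a + 3)) := by
  have hs := h.isChiralSystem hx hy
  rw [shiftedVector_eq_chiralVector]
  set P := chiralVector 𝒲 (fun a => if par a = 0 then x a else y a)
    (fun a => if par a = 0 then y a else x a) t
  have hP : P ∈ homog 𝒲.parity 0 := hs.chiralVector_mem t
  have hX := fun a => IsWeightVector.of_chiralBracket (hs.chiralVector_bracket_even t a)
    (hs.D_even a)
  have hY := fun a => IsWeightVector.of_chiralBracket (hs.chiralVector_bracket_odd t a)
    (hs.D_odd a)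
  have hxw : ∀ a, ∃ w, IsWeightVector 𝒲 P (x a) w := by
    intro a
    by_cases ha : par a = 0
    · exact ⟨_, by simpa only [ha, if_true] using hX a⟩
    · exact ⟨_, by simpa only [ha, if_false] using hY a⟩
  have hyw : ∀ a, ∃ w, IsWeightVector 𝒲 P (y a) w := by
    intro a
    by_cases ha : par a = 0
    · exact ⟨_, by simpa only [ha, if_true] using hY a⟩
    · exact ⟨_, by simpa only [ha, if_false] using hX a⟩
  -- Homogeneity is part of the induction because the product step needs a parity for the left
  -- factor.
  have hword : ∀ w : Word A, (∃ p, w.eval 𝒲 x y ∈ homog 𝒲.parity p) ∧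
      ∃ μ, IsWeightVector 𝒲 P (w.eval 𝒲 x y) μ := by
    intro w
    induction w with
    | vac => exact ⟨⟨_, 𝒲.vac_even⟩, _, .vac hP⟩
    | phi a => exact ⟨⟨_, h.mem_left a⟩, hxw a⟩
    | psi a => exact ⟨⟨_, h.mem_right a⟩, hyw a⟩
    | D i w ih =>
      obtain ⟨⟨p, hp⟩, μ, hμ⟩ := ih
      exact ⟨⟨_, 𝒲.D_odd i p _ hp⟩, _, hμ.D hP i⟩
    | mul w w' ih ih' =>
      obtain ⟨⟨p, hp⟩, μ, hμ⟩ := ih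
      obtain ⟨⟨p', hp'⟩, μ', hμ'⟩ := ih'
      exact ⟨⟨_, 𝒲.mul_parity p p' _ hp _ hp'⟩, _, hμ.mul hP hp hμ'⟩
  -- Both sides are linear in `v`, so agreement on the spanning words suffices.
  have hlin : ∀ (m : Mon) (T : Module.End ℂ W),
      (∀ v μ, IsWeightVector 𝒲 P v μ → 𝒲.bracket P v m = T v) →
      ∀ v, 𝒲.bracket P v m = T v := by
    intro m T hT v
    have : Finsupp.lapply m ∘ₗ 𝒲.bracket P = T := by
      refine LinearMap.ext_on_range hspan fun w => ?_
      obtain ⟨-, μ, hμ⟩ := hword w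
      exact hT _ μ hμ
    exact LinearMap.congr_fun this v
  refine ⟨hs.chiralVector_bracket_self t, ?_, ?_, ?_, ?_⟩
  · exact hlin _ ((2 : ℂ) • 𝒲.del) fun v μ hμ => hμ.coeff_one
  · exact hlin _ (𝒲.D 0) fun v μ hμ => hμ.coeff_chi_one
  · exact hlin _ (𝒲.D 1) fun v μ hμ => hμ.coeff_chi_two
  · rw [eq_top_iff, ← hspan, Submodule.span_le]
    rintro _ ⟨w, rfl⟩
    obtain ⟨-, μ, hμ⟩ := hword w
    exact Submodule.mem_iSup_of_mem μ (Module.End.mem_eigenspace_iff.mpr hμ.coeff_lam)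

end NK2

end

/-- The shifted vector is an `N = 2` superconformal vector, of central charge `∑ (6 t_a + 3)`, of
the `N = 2` SUSY `bc`-`βγ` system. -/
theorem theorem4p21 {A : Type u} [Fintype A] [DecidableEq A] (par : A → ZMod 2)
    {V : Type u} [AddCommGroup V] [Module ℂ V] (𝒱 : NK2.SUSYVertexAlgebra V) (Φ Ψ : A → V)
    (hV : NK2.IsUniversalEnvelope par 𝒱 Φ Ψ) (t : A → ℂ) :
    NK2.IsSuperconformalVector (NK2.bcBetaGamma 𝒱 Φ Ψ)
      (NK2.shiftedVector par (NK2.bcBetaGamma 𝒱 Φ Ψ)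
        (fun a => Submodule.Quotient.mk (Φ a)) (fun a => Submodule.Quotient.mk (Ψ a)) t)
      (∑ a, (6 * t a + 3)) := by
  have hq : NK2.IsHom 𝒱 (NK2.bcBetaGamma 𝒱 Φ Ψ) (NK2.relationIdeal 𝒱 Φ Ψ).mkQ :=
    NK2.isHom_mkQ 𝒱 _ (NK2.isIdeal_idealSpan 𝒱 _)
  have hrel : ∀ v, Complex.I • 𝒱.D 0 v - 𝒱.D 1 v ∈ NK2.relations 𝒱 Φ Ψ →
      (NK2.bcBetaGamma 𝒱 Φ Ψ).D 1 ((NK2.relationIdeal 𝒱 Φ Ψ).mkQ v) =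
        Complex.I • (NK2.bcBetaGamma 𝒱 Φ Ψ).D 0 ((NK2.relationIdeal 𝒱 Φ Ψ).mkQ v) := by
    intro v hv
    rw [← hq.D, ← hq.D, ← map_smul, eq_comm, ← sub_eq_zero, ← map_sub, Submodule.mkQ_apply,
      Submodule.Quotient.mk_eq_zero]
    exact Submodule.mem_sInf.mpr fun I hI => hI.2 hv
  refine (hV.realization.map hq).isSuperconformalVector
    (fun a => hrel _ (Or.inl ⟨a, rfl⟩)) (fun a => hrel _ (Or.inr ⟨a, rfl⟩)) ?_ t
  -- The quotient map sends words in the generators to words in their images, so the latter span the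
  -- quotient.
  have := congrArg (Submodule.map (NK2.relationIdeal 𝒱 Φ Ψ).mkQ) hV.span_eval
  rw [Submodule.map_span, ← Set.range_comp, Submodule.map_top, Submodule.range_mkQ] at this
  simpa only [Function.comp_def, hq.eval] using this
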